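/- Let $\mathbb{P}^{16}_{\mathbb{C}}$ have homogeneous coordinates $(h:M:x:y:r)$, with $M=(m_{ij})$ a $3\times 3$ matrix and $x=(x_1,x_2,x_3)$, $y=(y_1,y_2,y_3)$, and let $X\subseteq\mathbb{P}^{16}_{\mathbb{C}}$ be the compactification of the group of direct isometries of $\mathbb{R}^3$ given by $$MM^t=M^tM=h^2\,\mathrm{id},\quad \det M=h^3,\quad M^ty+hx=0,\quad Mx+hy=0,\quad \langle x,x\rangle=\langle y,y\rangle=rh .$$ Let $S$ be the linear subspace $\{M=M^t,\ x=y\}$ of $\mathbb{P}^{16}_{\mathbb{C}}$, and let $X_{\mathrm{inv}}$ (the compactification of the set of involutions) be the subvariety of $X\cap S$ given by $m_{11}+m_{22}+m_{33}+h=0$. Let $\check{\mathbb{P}}^{10}_{\mathbb{C}}$ have homogeneous coordinates $l$, $z_{ii}$ ($0\le i\le 3$), $s_{ij}$ ($0\le i<j\le 3$). It is dual to $S$ under the symmetric bilinear sphere condition $$l\,h+z_{00}\,r-4\sum_{i=1}^{3}s_{0i}x_i-2\sum_{i=1}^{3}z_{ii}m_{ii}-4\sum_{1\le i<j\le 3}s_{ij}m_{ij}=0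 .$$ Let $\pi\colon\check{\mathbb{P}}^{10}_{\mathbb{C}}\dashrightarrow\check{\mathbb{P}}^{9}_{\mathbb{C}}$ be the projection that removes the coordinate $l$, and let $p_e\in\check{\mathbb{P}}^{10}_{\mathbb{C}}$ be the point with $l=-2$, $z_{11}=z_{22}=z_{33}=1$ and all other coordinates zero. A Borel subspace is a $3$-dimensional projective linear subspace $\Gamma\subseteq\check{\mathbb{P}}^{9}_{\mathbb{C}}$ passing through $\pi(p_e)$. **Proposition.** Let $\Gamma$ be a Borel subspace that is defined over $\mathbb{R}$. Then there exists a $3$-dimensional projective linear subspace $\tilde\Gamma\subseteq\check{\mathbb{P}}^{10}_{\mathbb{C}}$, defined over $\mathbb{R}$ and passing through $p_e$, such that $\pi(\tilde\Gamma)=\Gamma$ and $X_{\mathrm{inv}}\cap\Lambda$ has a real component, where $\Lambda\subseteq S$ is the dual of $\tilde\Gamma$ under the symmetric bilinear sphere condition. Here a real component is an irreducible component of positive dimension in which the real points are Zariski dense. -/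

import Mathlib

open scoped LinearAlgebra.Projectivization Matrix

/-- Names of the 17 homogeneous coordinates `(h : M : x : y : r)` of the projective space
containing the compactification of the group of direct isometries of `ℝ³`. -/
inductive IsoCoord : Type
  | h : IsoCoord
  | m : Fin 3 → Fin 3 → IsoCoord
  | x : Fin 3 → IsoCoord
  | y : Fin 3 → IsoCoord
  | r : IsoCoord

/-- The complex projective space `ℙ¹⁶` with coordinates `(h : M : x : y : r)`. -/
abbrev IsoSpace : Type := ℙ ℂ (IsoCoord → ℂ)

/-- The matrix `M = (m_ij)` of a coordinate vector. -/
def matPart (v : IsoCoord → ℂ) : Matrix (Fin 3) (Fin 3) ℂ :=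
  Matrix.of fun i j => v (IsoCoord.m i j)

/-- The vector `x` of a coordinate vector. -/
def xPart (v : IsoCoord → ℂ) : Fin 3 → ℂ := fun i => v (IsoCoord.x i)

/-- The vector `y` of a coordinate vector. -/
def yPart (v : IsoCoord → ℂ) : Fin 3 → ℂ := fun i => v (IsoCoord.y i)

/-- The homogeneous equations of the compactification of the group of direct isometries. -/
structure IsoEquations (v : IsoCoord → ℂ) : Prop where
  mul_transpose : matPart v * (matPart v)ᵀ = v IsoCoord.h ^ 2 • (1 : Matrix (Fin 3) (Fin 3) ℂ)
  transpose_mul : (matPart v)ᵀ * matPart v = v IsoCoord.h ^ 2 • (1 : Matrix (Fin 3) (Fin 3) ℂ)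
  det_eq : (matPart v).det = v IsoCoord.h ^ 3
  transpose_mulVec : (matPart v)ᵀ *ᵥ yPart v + v IsoCoord.h • xPart v = 0
  mulVec : matPart v *ᵥ xPart v + v IsoCoord.h • yPart v = 0
  x_sq : xPart v ⬝ᵥ xPart v = v IsoCoord.r * v IsoCoord.h
  y_sq : yPart v ⬝ᵥ yPart v = v IsoCoord.r * v IsoCoord.h

/-- The compactification `X ⊆ ℙ¹⁶` of the group of direct isometries. -/
def isoVariety : Set IsoSpace := {p | IsoEquations p.rep}

/-- The linear subspace `S ⊆ ℙ¹⁶` with equations `M = Mᵗ` and `x = y`. -/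
def symSpace : Set IsoSpace :=
  {p | (matPart p.rep)ᵀ = matPart p.rep ∧ xPart p.rep = yPart p.rep}

/-- The compactification `X_inv` of the set of involutions: the points of `X` with `M = Mᵗ`,
`x = y` and `m₁₁ + m₂₂ + m₃₃ + h = 0`. -/
def invVariety : Set IsoSpace :=
  {p | p ∈ isoVariety ∧ p ∈ symSpace ∧ (matPart p.rep).trace + p.rep IsoCoord.h = 0}

/-- The vector space under the dual projective space of dimension `9`. The coordinate with index
`s(i, i)` is `z_ii`, and for `i < j` the coordinate with index `s(i, j)` is `s_ij`. -/
abbrev SymLeg : Type := Sym2 (Fin 4) → ℂ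

/-- The vector space under the dual projective space of dimension `10`: the coordinate `l`, then
the coordinates `z_ii` and `s_ij`. -/
abbrev SymLegL : Type := ℂ × SymLeg

/-- The projection `π` that removes the coordinate `l`. -/
def projL : SymLegL →ₗ[ℂ] SymLeg := LinearMap.snd ℂ ℂ SymLeg

/-- The point `p_e`: `l = -2`, `z₁₁ = z₂₂ = z₃₃ = 1`, and all other coordinates are zero. -/
def pE : SymLegL :=
  (-2, fun q => if q = s(1, 1) ∨ q = s(2, 2) ∨ q = s(3, 3) then 1 else 0)

/-- The left hand side of the symmetric bilinear sphere condition. -/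
def symSphereForm (v : IsoCoord → ℂ) (w : SymLegL) : ℂ :=
  w.1 * v IsoCoord.h + w.2 s(0, 0) * v IsoCoord.r
    - 4 * ∑ i : Fin 3, w.2 s(0, i.succ) * v (IsoCoord.x i)
    - 2 * ∑ i : Fin 3, w.2 s(i.succ, i.succ) * v (IsoCoord.m i i)
    - 4 * ∑ i : Fin 3, ∑ j ∈ Finset.Ioi i, w.2 s(i.succ, j.succ) * v (IsoCoord.m i j)

/-- The dual in `S` of a linear subspace under the symmetric bilinear sphere condition. -/
def dualInS (G : Submodule ℂ SymLegL) : Set IsoSpace :=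
  {p | p ∈ symSpace ∧ ∀ w ∈ G, symSphereForm p.rep w = 0}

/-- A Borel subspace: a projective `3`-space (a linear subspace of dimension `4`) of the dual
projective space of dimension `9` that passes through `π(p_e)`. -/
def IsBorelSubspace (G : Submodule ℂ SymLeg) : Prop :=
  Module.finrank ℂ G = 4 ∧ projL pE ∈ G

/-- A complex linear subspace is defined over `ℝ` when it is stable under complex conjugation. -/
def IsDefinedOverReals {V : Type*} [AddCommGroup V] [Module ℂ V] [Star V]
    (W : Submodule ℂ V) : Prop :=
  ∀ v ∈ W, star v ∈ W

/-- The Zariski topology on `ℙ¹⁶`: its closed sets are the zero loci of sets of homogeneous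
polynomials. -/
instance zariskiTopology : TopologicalSpace IsoSpace :=
  TopologicalSpace.generateFrom
    {U | ∃ (n : ℕ) (f : MvPolynomial IsoCoord ℂ), f.IsHomogeneous n ∧
      U = {p : IsoSpace | MvPolynomial.eval p.rep f ≠ 0}}

/-- The real points of `ℙ¹⁶`: those with a representative all of whose coordinates are real. -/
def realPoints : Set IsoSpace :=
  {p | ∃ (v : IsoCoord → ℂ) (hv : v ≠ 0), (∀ c, (v c).im = 0) ∧ p = Projectivization.mk ℂ v hv}

/-- `Z` is an irreducible component of the subset `A` of `ℙ¹⁶`, in the Zariski topology. -/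
def IsIrredComponent (A Z : Set IsoSpace) : Prop :=
  Maximal (fun T : Set IsoSpace => IsIrreducible T ∧ T ⊆ A) Z

/-- `A` has a real component: an irreducible component of positive dimension (that is, with
infinitely many points) in which the real points are Zariski dense. -/
def HasRealComponent (A : Set IsoSpace) : Prop :=
  ∃ Z : Set IsoSpace, IsIrredComponent A Z ∧ Z.Infinite ∧ Z ⊆ closure (Z ∩ realPoints)

/-!
The real half-turns whose axis is not parallel to the plane of the first two coordinates are
parametrized by the real quintuples `z = (a, b, c, d, s)` with `s (a² + b² + 1) = 1`: the axis has
direction `u = (a, b, 1)`, the matrix is `2 s u uᵗ - 1`, and `x = y = (c, d, -(ac + bd))` is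
orthogonal to `u`. On the open set `h (m₃₃ + h) ≠ 0` of `X_inv` this is a bijective chart
(`halfTurn`, `chart`, `eq_smul_halfTurn_chart`).

Lifting `Γ` linearly so that it becomes orthogonal to a real half-turn `v₀` always gives a real lift
through `p_e` (`legLift`), because the form of `p_e` is the equation `tr M + h = 0`. The points of
`X_inv` dual to the lift are those at which every form in `Γ` takes, for `h = 1`, the same value as
at `v₀`. So the question is whether some fiber of a polynomial family has a real component. The
forms in `Γ` that are real pull back to polynomials in the five parameters which span a real space
of dimension at most `4`, so their gradients never span `ℝ⁵`; this is why the fibers have positive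
dimension. The point `π(p_e)` of `Γ` contributes the equation `s (a² + b² + 1) = 1` of the parameter
space itself.

The base point is chosen so that the rank of the gradients is maximal
(`exists_coordinates_of_maximal_rank`). The inverse function theorem then parametrizes the real
fiber near that point by real analytic functions `φ` of some coordinate functions. Let `E` be the
image of `φ`. Its vanishing ideal is prime, because the analytic functions on a ball form a domain.
It is also minimal over the equations of the fiber: if a prime ideal `P` contains these equations
and vanishes on `E`, the Jacobian criterion (`exists_aeval_mem_of_jacobian_notMem`) makes every
polynomial algebraic modulo `P` over the free coordinates, so a polynomial `f ∉ P` that vanished on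
`E` would divide, modulo `P`, a nonzero polynomial in the free coordinates that vanishes on a box,
which is absurd. Both facts are `exists_zariski_dense_real_fiber`.

Transported to `ℙ¹⁶`, the set `E` becomes an infinite irreducible set of real points such that every
irreducible subset of `X_inv ∩ Λ` containing it lies in its Zariski closure. Hence that closure,
intersected with `X_inv ∩ Λ`, is the required real component.
-/

/-! ### A Jacobian criterion for algebraic dependence modulo a prime ideal -/

open MvPolynomial in
theorem MvPolynomial.derivation_algHom_eq_sum {σ k L M : Type*} [Fintype σ] [Field k] [Field L]
    [Algebra k L] [AddCommGroup M] [Module L M] [Module k M] [IsScalarTower k L M]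
    (d : Derivation k L M) (φ : MvPolynomial σ k →ₐ[k] L) (p : MvPolynomial σ k) :
    d (φ p) = ∑ i, φ (pderiv i p) • d (φ (X i)) := by
  induction p using MvPolynomial.induction_on with
  | C a => simp [← MvPolynomial.algebraMap_eq]
  | add p q hp hq => simp [hp, hq, add_smul, Finset.sum_add_distrib]
  | mul_X p j hp =>
    classical
    have hs (i : σ) : φ (Pi.single (M := fun _ => MvPolynomial σ k) i 1 j) =
        if i = j then 1 else 0 := by
      by_cases h : i = j <;> simp [h]
    simp only [map_mul, Derivation.leibniz, hp, pderiv_X, map_add, smul_eq_mul, add_smul,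
      Finset.sum_add_distrib, Finset.smul_sum, smul_smul, mul_comm (φ (X j))]
    simp [hs]

open MvPolynomial in
/-- If the Jacobian determinant of `Q` does not vanish in `L`, then `L` is separable over the field
generated by the values of `Q`: the differentials of the generators of `L` are killed by an
invertible matrix, so `L` is formally unramified over that field. -/
theorem isSeparable_adjoin_of_jacobian_ne_zero {σ k L : Type*} [Fintype σ] [DecidableEq σ]
    [Field k] [Field L] [Algebra k L] [Algebra.EssFiniteType k L]
    (φ : MvPolynomial σ k →ₐ[k] L)
    (hφ : ∀ x : L, ∃ p q, φ q ≠ 0 ∧ x * φ q = φ p)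
    (Q : σ → MvPolynomial σ k)
    (hdet : φ (Matrix.of fun j i => pderiv i (Q j)).det ≠ 0) :
    Algebra.IsSeparable (IntermediateField.adjoin k (Set.range fun j => φ (Q j))) L := by
  set K := IntermediateField.adjoin k (Set.range fun j => φ (Q j)) with hK
  have : Algebra.EssFiniteType K L := .of_comp k K L
  have hsub : Subsingleton (Ω[L⁄K]) := by
    let d : Derivation k L (Ω[L⁄K]) := (KaehlerDifferential.D K L).restrictScalars k
    have hdQ (j : σ) : d (φ (Q j)) = 0 := by
      have hmem : φ (Q j) ∈ K := IntermediateField.subset_adjoin _ _ ⟨j, rfl⟩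
      exact (KaehlerDifferential.D K L).map_algebraMap ⟨_, hmem⟩
    have hdX (i : σ) : d (φ (X i)) = 0 := by
      set A : Matrix σ σ L := Matrix.of fun j i => φ (pderiv i (Q j)) with hA
      have hAdet : A.det ≠ 0 := by
        rw [AlgHom.map_det] at hdet
        exact hdet
      have hB : A⁻¹ * A = 1 := Matrix.nonsing_inv_mul A (isUnit_iff_ne_zero.mpr hAdet)
      calc d (φ (X i)) = ∑ l, (A⁻¹ * A) i l • d (φ (X l)) := by
            rw [hB, Finset.sum_eq_single i] <;> simp +contextual [eq_comm]
        _ = ∑ j, A⁻¹ i j • ∑ l, A j l • d (φ (X l)) := by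
            simp only [Matrix.mul_apply, Finset.sum_smul, Finset.smul_sum, smul_smul]
            rw [Finset.sum_comm]
        _ = 0 := by
            refine Finset.sum_eq_zero fun j _ => ?_
            have := MvPolynomial.derivation_algHom_eq_sum d φ (Q j)
            rw [hdQ] at this
            simp [hA, ← this]
    have hdφ (p : MvPolynomial σ k) : d (φ p) = 0 := by
      rw [MvPolynomial.derivation_algHom_eq_sum]
      simp [hdX]
    have hd (x : L) : d x = 0 := by
      obtain ⟨p, q, hq, h⟩ := hφ x
      have h1 := congrArg d h
      rw [Derivation.leibniz, hdφ, hdφ, smul_zero, zero_add] at h1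
      exact (smul_eq_zero.mp h1).resolve_left hq
    have htop := KaehlerDifferential.span_range_derivation K L
    have hrange : Set.range (KaehlerDifferential.D K L) ⊆ {0} := by
      rintro _ ⟨x, rfl⟩
      exact hd x
    have hbot := Submodule.span_mono (R := L) hrange
    rw [htop, Submodule.span_zero_singleton, top_le_iff] at hbot
    exact (Submodule.subsingleton_iff L).mp (subsingleton_of_bot_eq_top hbot)
  have : Algebra.FormallyUnramified K L := (Algebra.formallyUnramified_iff K L).mpr hsub
  exact Algebra.FormallyUnramified.isSeparable K L

open MvPolynomial in
/-- Modulo a prime `P` that does not contain the Jacobian determinant of `Q`, every `f ∉ P` divides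
a nonzero polynomial expression in the `Q j`, since `f` is algebraic over the field they generate.
-/
theorem exists_aeval_mem_of_jacobian_notMem {σ k : Type*} [Fintype σ] [DecidableEq σ] [Field k]
    (P : Ideal (MvPolynomial σ k)) [P.IsPrime] (Q : σ → MvPolynomial σ k)
    (hdet : (Matrix.of fun j i => pderiv i (Q j)).det ∉ P) {f : MvPolynomial σ k} (hf : f ∉ P) :
    ∃ a : MvPolynomial σ k, aeval Q a ∉ P ∧ aeval Q a ∈ P ⊔ Ideal.span {f} := by
  let S := MvPolynomial σ k ⧸ P
  let L := FractionRing S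
  let φ : MvPolynomial σ k →ₐ[k] L := (IsScalarTower.toAlgHom k S L).comp (Ideal.Quotient.mkₐ k P)
  have hker (p : MvPolynomial σ k) : φ p = 0 ↔ p ∈ P := by
    simp [φ, S, L, Ideal.Quotient.eq_zero_iff_mem]
  have : Algebra.EssFiniteType S L := .of_isLocalization _ (nonZeroDivisors S)
  have : Algebra.EssFiniteType k L := .comp k S L
  have hsep := isSeparable_adjoin_of_jacobian_ne_zero φ (fun x => by
    obtain ⟨p, q, hq, rfl⟩ := IsFractionRing.div_surjective S x
    obtain ⟨p, rfl⟩ := Ideal.Quotient.mk_surjective p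
    obtain ⟨q, rfl⟩ := Ideal.Quotient.mk_surjective q
    have hq' : φ q ≠ 0 := fun h => nonZeroDivisors.ne_zero hq
      (Ideal.Quotient.eq_zero_iff_mem.mpr ((hker q).mp h))
    exact ⟨p, q, hq', div_mul_cancel₀ _ hq'⟩) Q ((hker _).not.mpr hdet)
  set T : Set L := Set.range fun j => φ (Q j) with hT
  have hT_le : Algebra.adjoin k T ≤ φ.range := by
    rw [Algebra.adjoin_le_iff]
    rintro _ ⟨j, rfl⟩
    exact ⟨Q j, rfl⟩
  have halg : IsAlgebraic (Algebra.adjoin k T) (φ f) := by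
    open scoped IntermediateField.algebraAdjoinAdjoin in
    exact (IsFractionRing.isAlgebraic_iff (Algebra.adjoin k T)
      (IntermediateField.adjoin k T) L).mpr (Algebra.IsAlgebraic.isAlgebraic (φ f))
  -- The constant term of a suitable algebraic equation of `f` is a multiple of `f`.
  obtain ⟨p, hp0, hp⟩ := halg.exists_nonzero_coeff_and_aeval_eq_zero
    (mem_nonZeroDivisors_of_ne_zero ((hker f).not.mpr hf))
  obtain ⟨g, hg⟩ : ∃ g, φ g = Polynomial.aeval (φ f) p.divX := by
    change _ ∈ φ.range
    rw [Polynomial.aeval_eq_sum_range]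
    refine Subalgebra.sum_mem _ fun i _ => ?_
    exact Subalgebra.mul_mem _ (hT_le (p.divX.coeff i).2) 
      (Subalgebra.pow_mem _ (φ.mem_range_self f) i)
  obtain ⟨a, ha⟩ : ∃ a, aeval (fun j => φ (Q j)) a = (p.coeff 0 : L) := by
    have hmem := (Algebra.adjoin_range_eq_range_aeval k fun j => φ (Q j)).le (p.coeff 0).2
    exact hmem
  have haφ : φ (aeval Q a) = p.coeff 0 := by
    rw [← ha, ← AlgHom.comp_apply]
    congr 1
    ext j
    simp
  have hsum : (p.coeff 0 : L) + φ f * φ g = 0 := by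
    have h := congrArg (Polynomial.aeval (φ f)) p.divX_mul_X_add
    rw [hp, map_add, map_mul, Polynomial.aeval_X, Polynomial.aeval_C] at h
    rw [hg, mul_comm, add_comm]
    exact h
  refine ⟨a, fun h => hp0 ?_, ?_⟩
  · rw [← hker, haφ] at h
    exact Subtype.ext h
  · have h : aeval Q a + f * g ∈ P := by
      rw [← hker, map_add, map_mul, haφ, hsum]
    have h2 : f * g ∈ P ⊔ Ideal.span {f} :=
      Ideal.mem_sup_right (Ideal.mul_mem_right _ _ (Ideal.mem_span_singleton_self f))
    simpa using Ideal.sub_mem _ (Ideal.mem_sup_left h) h2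

/-! ### Gradients of polynomials and local coordinates at a point of maximal rank -/

/-- The gradient of a polynomial `p` at the point `x`. -/
noncomputable def MvPolynomial.gradAt {σ R : Type*} [CommSemiring R] (x : σ → R) :
    MvPolynomial σ R →ₗ[R] (σ → R) where
  toFun p i := eval x (pderiv i p)
  map_add' p q := by ext; simp
  map_smul' r p := by ext; simp

open MvPolynomial in
theorem MvPolynomial.gradAt_apply {σ R : Type*} [CommSemiring R] (x : σ → R)
    (p : MvPolynomial σ R) (i : σ) : gradAt x p i = eval x (pderiv i p) := rfl

open MvPolynomial in
theorem MvPolynomial.gradAt_X {σ R : Type*} [DecidableEq σ] [CommSemiring R] (x : σ → R) (j : σ) :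
    gradAt x (X j) = Pi.single j 1 := by
  ext i
  by_cases h : i = j
  · subst h
    simp [gradAt_apply]
  · simp [gradAt_apply, h, pderiv_X_of_ne (Ne.symm h)]

/-- The linear form with a given coefficient vector, as a continuous linear map. -/
noncomputable def dotProductCLM {σ : Type*} [Fintype σ] :
    (σ → ℝ) →ₗ[ℝ] ((σ → ℝ) →L[ℝ] ℝ) where
  toFun v := ∑ i, v i • ContinuousLinearMap.proj (R := ℝ) (φ := fun _ : σ => ℝ) i
  map_add' v w := by simp [add_smul, Finset.sum_add_distrib]
  map_smul' r v := by simp [mul_smul, Finset.smul_sum]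

theorem dotProductCLM_apply {σ : Type*} [Fintype σ] (v w : σ → ℝ) :
    dotProductCLM v w = ∑ i, v i * w i := by
  simp [dotProductCLM]

open MvPolynomial in
theorem MvPolynomial.hasFDerivAt_eval {σ : Type*} [Fintype σ] (p : MvPolynomial σ ℝ) (x : σ → ℝ) :
    HasFDerivAt (fun y : σ → ℝ => eval y p) (dotProductCLM (gradAt x p)) x := by
  classical
  induction p using MvPolynomial.induction_on with
  | C a =>
    have : gradAt x (C a) = 0 := by ext; simp [gradAt_apply]
    simpa [this] using hasFDerivAt_const a x
  | add p q hp hq =>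
    simp only [map_add]
    exact hp.add hq
  | mul_X p j hp =>
    have hj : HasFDerivAt (fun y : σ → ℝ => y j)
      (ContinuousLinearMap.proj (R := ℝ) (φ := fun _ : σ => ℝ) j) x := hasFDerivAt_apply j x
    have h : HasFDerivAt (fun y : σ → ℝ => eval y p * y j) _ x := hp.mul hj
    simp only [map_mul, eval_X]
    refine h.congr_fderiv ?_
    ext w
    have hj1 (i : σ) : eval x (Pi.single (M := fun _ => MvPolynomial σ ℝ) i 1 j) =
        if i = j then 1 else 0 := by
      by_cases h : i = j <;> simp [h]
    simp [dotProductCLM_apply, gradAt_apply, Derivation.leibniz, Finset.sum_add_distrib, add_mul,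
      hj1, Finset.mul_sum, mul_assoc, pderiv_X, mul_ite, ite_mul]

open MvPolynomial in
theorem MvPolynomial.analyticAt_eval {σ : Type*} [Fintype σ] (p : MvPolynomial σ ℝ) (x : σ → ℝ) :
    AnalyticAt ℝ (fun y : σ → ℝ => eval y p) x := by
  simpa using AnalyticAt.aeval_mvPolynomial (A := ℝ) (f := fun y : σ → ℝ => y) (z := x)
    (fun i => (ContinuousLinearMap.proj (R := ℝ) (φ := fun _ : σ => ℝ) i).analyticAt x) p

theorem AnalyticOnNhd.eqOn_zero_or_eqOn_zero_of_mul {E : Type*} [NormedAddCommGroup E]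
    [NormedSpace ℝ E] {U : Set E} (hUo : IsOpen U) (hU : IsPreconnected U) {f g : E → ℂ}
    (hf : AnalyticOnNhd ℝ f U) (hg : AnalyticOnNhd ℝ g U) (hfg : ∀ x ∈ U, f x * g x = 0) :
    (∀ x ∈ U, f x = 0) ∨ ∀ x ∈ U, g x = 0 := by
  by_contra! hne
  obtain ⟨⟨x, hxU, hx⟩, y, hyU, hy⟩ := hne
  refine hy (hg.eqOn_zero_of_preconnected_of_eventuallyEq_zero hU hxU ?_ hyU)
  filter_upwards [(hf x hxU).continuousAt.eventually_ne hx, hUo.mem_nhds hxU] with z hz hzU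
  exact (mul_eq_zero.mp (hfg z hzU)).resolve_left hz

/-- The coordinate functions together with a family of polynomials `H`. -/
noncomputable def withCoordinates {ι σ R : Type*} [CommSemiring R] (H : ι → MvPolynomial σ R) :
    ι ⊕ σ → MvPolynomial σ R :=
  Sum.elim H MvPolynomial.X

open MvPolynomial in
/-- At a point `x₀` of the locus `H i₀ = c` where the gradients of `H` have maximal rank, finitely
many members of `H`, among them `H i₀`, can be completed by coordinate functions to a local
coordinate system, in such a way that they control the gradients of all of `H` wherever on the locus
the chosen functions remain a local coordinate system. -/
theorem exists_coordinates_of_maximal_rank {n : ℕ} {ι : Type*} (H : ι → MvPolynomial (Fin n) ℝ)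
    (i₀ : ι) (c : ℝ) (hne : ∃ x, eval x (H i₀) = c)
    (hgrad : ∀ x, eval x (H i₀) = c → gradAt x (H i₀) ≠ 0)
    (hrank : ∀ x, Module.finrank ℝ (Submodule.span ℝ (Set.range fun i => gradAt x (H i))) < n) :
    ∃ x₀ : Fin n → ℝ, eval x₀ (H i₀) = c ∧ ∃ e : Fin n → ι ⊕ Fin n,
      LinearIndependent ℝ (fun k => gradAt x₀ (withCoordinates H (e k))) ∧
      (∃ k, e k = Sum.inl i₀) ∧ (∃ k j, e k = Sum.inr j) ∧
      ∀ x, eval x (H i₀) = c →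
        LinearIndependent ℝ (fun k => gradAt x (withCoordinates H (e k))) →
        ∀ i, gradAt x (H i) ∈
          Submodule.span ℝ (Set.range fun k : {k // ∃ j, e k = Sum.inl j} =>
            gradAt x (withCoordinates H (e k))) := by
  classical
  set V : (Fin n → ℝ) → Submodule ℝ (Fin n → ℝ) :=
    fun x => Submodule.span ℝ (Set.range fun i => gradAt x (H i)) with hV
  -- a point of the locus at which the rank is maximal
  obtain ⟨x₀, hx₀, hmax⟩ : ∃ x₀, eval x₀ (H i₀) = c ∧
      ∀ x, eval x (H i₀) = c → Module.finrank ℝ (V x) ≤ Module.finrank ℝ (V x₀) := by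
    have hfin : ((fun x => Module.finrank ℝ (V x)) '' {x | eval x (H i₀) = c}).Finite :=
      (Set.finite_Iio n).subset (by rintro _ ⟨x, -, rfl⟩; exact hrank x)
    obtain ⟨x, hx⟩ := hne
    obtain ⟨_, ⟨x₀, hx₀, rfl⟩, h⟩ := Set.exists_max_image _ id hfin ⟨_, x, hx, rfl⟩
    exact ⟨x₀, hx₀, fun y hy => h _ ⟨y, hy, rfl⟩⟩
  refine ⟨x₀, hx₀, ?_⟩
  set w : ι ⊕ Fin n → (Fin n → ℝ) := fun k => gradAt x₀ (withCoordinates H k) with hw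
  have h0 : LinearIndepOn ℝ w {Sum.inl i₀} := by
    rw [linearIndepOn_singleton_iff]
    exact hgrad x₀ hx₀
  have hsub0 : ({Sum.inl i₀} : Set (ι ⊕ Fin n)) ⊆ Set.range Sum.inl := by simp
  set S₁ := h0.extend hsub0
  have h1 : LinearIndepOn ℝ w S₁ := h0.linearIndepOn_extend hsub0
  set S₂ := h1.extend (Set.subset_univ S₁)
  have h2 : LinearIndepOn ℝ w S₂ := h1.linearIndepOn_extend _
  have hspan1 : Submodule.span ℝ (w '' S₁) = V x₀ := by
    rw [h0.span_image_extend_eq_span_image hsub0, ← Set.range_comp]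
    rfl
  have hspan2 : Submodule.span ℝ (w '' S₂) = ⊤ := by
    rw [h1.span_image_extend_eq_span_image, Set.image_univ, eq_top_iff,
      ← (Pi.basisFun ℝ (Fin n)).span_eq]
    refine Submodule.span_mono ?_
    rintro _ ⟨j, rfl⟩
    exact ⟨Sum.inr j, by simp [hw, withCoordinates, gradAt_X]⟩
  let b : Module.Basis S₂ ℝ (Fin n → ℝ) := Module.Basis.mk (v := fun k : S₂ => w k) h2 (by
    rw [← hspan2, Set.image_eq_range])
  have : Finite S₂ := Module.Finite.finite_basis b
  have := Fintype.ofFinite S₂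
  have hcard : Fintype.card S₂ = n := by
    simpa using (Module.finrank_eq_card_basis b).symm
  let e' : Fin n ≃ S₂ := (Fintype.equivFinOfCardEq hcard).symm
  set T := {k : Fin n // ∃ j, (e' k : ι ⊕ Fin n) = Sum.inl j}
  have hliT (x : Fin n → ℝ)
      (hx : LinearIndependent ℝ fun k => gradAt x (withCoordinates H (e' k))) :
      LinearIndependent ℝ (fun k : T => gradAt x (withCoordinates H (e' k.1))) :=
    hx.comp _ Subtype.val_injective
  have hle (x : Fin n → ℝ) : Submodule.span ℝ
      (Set.range fun k : T => gradAt x (withCoordinates H (e' k.1))) ≤ V x := by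
    refine Submodule.span_mono ?_
    rintro _ ⟨⟨k, j, hj⟩, rfl⟩
    exact ⟨j, by simp [hj, withCoordinates]⟩
  have hli₀ : LinearIndependent ℝ fun k => gradAt x₀ (withCoordinates H (e' k)) :=
    LinearIndependent.comp h2 e' e'.injective
  have hmem (s : ι ⊕ Fin n) (hs : s ∈ S₂) : ∃ k, (e' k : ι ⊕ Fin n) = s :=
    ⟨e'.symm ⟨s, hs⟩, by simp⟩
  -- at `x₀` the chosen gradients form a basis of the span of all gradients
  have hcardT : Fintype.card T = Module.finrank ℝ (V x₀) := by
    rw [← finrank_span_eq_card (hliT x₀ hli₀)]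
    refine congrArg (fun W : Submodule ℝ (Fin n → ℝ) => Module.finrank ℝ W)
      (le_antisymm (hle x₀) ?_)
    rw [← hspan1]
    refine Submodule.span_mono ?_
    rintro _ ⟨s, hs, rfl⟩
    obtain ⟨k, hk⟩ := hmem s (h1.subset_extend _ hs)
    obtain ⟨j, rfl⟩ := h0.extend_subset hsub0 hs
    exact ⟨⟨k, j, hk⟩, by simp [hw, hk]⟩
  refine ⟨fun k => e' k, hli₀, hmem _ (h1.subset_extend _ (h0.subset_extend _ rfl)), ?_, ?_⟩
  · by_contra! hcon
    have : Fintype.card T = n := by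
      rw [Fintype.card_subtype, Finset.filter_true_of_mem, Finset.card_fin]
      intro k _
      rcases hk : (e' k : ι ⊕ Fin n) with j | j
      · exact ⟨j, rfl⟩
      · exact absurd hk (hcon k j)
    exact (hrank x₀).ne (hcardT.symm.trans this)
  · intro x hx hli i
    have heq := Submodule.eq_of_le_of_finrank_le (hle x) (by
      rw [finrank_span_eq_card (hliT x hli), hcardT]
      exact hmax x hx)
    rw [heq]
    exact Submodule.subset_span ⟨i, rfl⟩

open MvPolynomial in
/-- The analytic inverse function theorem for a map `ℝⁿ → ℝⁿ` with polynomial components. -/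
theorem exists_analytic_localInverse {n : ℕ} (Q : Fin n → MvPolynomial (Fin n) ℝ) (x₀ : Fin n → ℝ)
    (hli : LinearIndependent ℝ fun k => gradAt x₀ (Q k)) :
    ∃ (Ψ : (Fin n → ℝ) → (Fin n → ℝ)) (ε : ℝ), 0 < ε ∧
      Ψ (fun k => eval x₀ (Q k)) = x₀ ∧
      AnalyticOnNhd ℝ Ψ (Metric.ball (fun k => eval x₀ (Q k)) ε) ∧
      ∀ y ∈ Metric.ball (fun k => eval x₀ (Q k)) ε,
        (∀ k, eval (Ψ y) (Q k) = y k) ∧ LinearIndependent ℝ fun k => gradAt (Ψ y) (Q k) := by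
  classical
  set Φ : (Fin n → ℝ) → (Fin n → ℝ) := fun x k => eval x (Q k) with hΦ
  let J : (Fin n → ℝ) → Matrix (Fin n) (Fin n) ℝ := fun x => Matrix.of fun k => gradAt x (Q k)
  have hJ (x) : LinearIndependent ℝ (fun k => gradAt x (Q k)) ↔ (J x).det ≠ 0 := by
    rw [← isUnit_iff_ne_zero, ← Matrix.isUnit_iff_isUnit_det,
      ← Matrix.linearIndependent_rows_iff_isUnit]
    rfl
  have hJcont : Continuous fun x => (J x).det := by
    refine Continuous.matrix_det (continuous_matrix fun k i => ?_)
    exact continuous_iff_continuousAt.mpr fun x => (analyticAt_eval (pderiv i (Q k)) x).continuousAt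
  let f' : (Fin n → ℝ) →L[ℝ] (Fin n → ℝ) :=
    ContinuousLinearMap.pi fun k => dotProductCLM (gradAt x₀ (Q k))
  have hf'_apply (v : Fin n → ℝ) : f' v = (J x₀) *ᵥ v := by
    ext k
    simp [f', J, dotProductCLM_apply, Matrix.mulVec, dotProduct]
  have hker : LinearMap.ker f'.toLinearMap = ⊥ := by
    rw [LinearMap.ker_eq_bot']
    intro v hv
    have hv' : (J x₀) *ᵥ v = 0 := by rw [← hf'_apply]; exact hv
    exact Matrix.eq_zero_of_mulVec_eq_zero ((hJ x₀).mp hli) hv'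
  let A : (Fin n → ℝ) ≃L[ℝ] (Fin n → ℝ) :=
    (LinearEquiv.ofInjectiveEndo f'.toLinearMap
      (LinearMap.ker_eq_bot.mp hker)).toContinuousLinearEquiv
  have hA : (A : (Fin n → ℝ) →L[ℝ] (Fin n → ℝ)) = f' := by
    ext v
    rfl
  have hder : HasFDerivAt Φ (A : (Fin n → ℝ) →L[ℝ] (Fin n → ℝ)) x₀ := by
    rw [hA]
    exact hasFDerivAt_pi.mpr fun k => hasFDerivAt_eval (Q k) x₀
  have hcd : ContDiffAt ℝ ⊤ Φ x₀ :=
    (AnalyticAt.pi fun k => analyticAt_eval (Q k) x₀).contDiffAt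
  have htop : (⊤ : WithTop ℕ∞) ≠ 0 := by simp
  have hstrict := hcd.hasStrictFDerivAt' hder htop
  set Ψ := hstrict.localInverse Φ A x₀ with hΨ
  have hΨ0 : Ψ (Φ x₀) = x₀ := hstrict.localInverse_apply_image
  have hΨan : AnalyticAt ℝ Ψ (Φ x₀) := (hcd.to_localInverse hder htop).analyticAt
  have hdet : ∀ᶠ y in nhds (Φ x₀), (J (Ψ y)).det ≠ 0 := by
    refine (hJcont.continuousAt.comp hΨan.continuousAt).eventually_ne ?_
    simpa [hΨ0] using (hJ x₀).mp hli
  obtain ⟨ε, hε, hball⟩ := Metric.eventually_nhds_iff_ball.mp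
    (hΨan.eventually_analyticAt.and (hstrict.eventually_right_inverse.and hdet))
  exact ⟨Ψ, ε, hε, hΨ0, fun y hy => (hball y hy).1, fun y hy =>
    ⟨fun k => congrFun (hball y hy).2.1 k, (hJ _).mpr (hball y hy).2.2⟩⟩

/-! ### Generic real fibers of polynomial families -/

open MvPolynomial in
theorem eval_ofReal_map {σ : Type*} (p : MvPolynomial σ ℝ) (x : σ → ℝ) :
    eval (fun i => (x i : ℂ)) (map Complex.ofRealHom p) = (eval x p : ℝ) := by
  rw [eval_map]
  exact (eval₂_comp_left Complex.ofRealHom (RingHom.id ℝ) x p).symm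

open MvPolynomial in
theorem eval_aeval_eq {σ τ R : Type*} [CommSemiring R] (x : τ → R) (Q : σ → MvPolynomial τ R)
    (p : MvPolynomial σ R) : eval x (aeval Q p) = eval (fun k => eval x (Q k)) p := by
  induction p using MvPolynomial.induction_on with
  | C a => simp
  | add p q hp hq => rw [map_add, map_add, hp, hq, map_add]
  | mul_X p j hp => rw [map_mul, map_mul, hp, aeval_X, map_mul, eval_X]

open MvPolynomial in
/-- If the gradients of `H` span less than `ℝⁿ` everywhere, then some point `x₀` of the locus `H i₀
= c` has an infinite set `E` in its real fiber whose vanishing ideal over `ℂ` is prime and is the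
only prime ideal contained in it that contains the equations of the fiber. Geometrically, the
Zariski closure of `E` is an irreducible component of the complex fiber. -/
theorem exists_zariski_dense_real_fiber {n : ℕ} {ι : Type*} (H : ι → MvPolynomial (Fin n) ℝ)
    (i₀ : ι) (c : ℝ) (hne : ∃ x, eval x (H i₀) = c)
    (hgrad : ∀ x, eval x (H i₀) = c → gradAt x (H i₀) ≠ 0)
    (hrank : ∀ x, Module.finrank ℝ (Submodule.span ℝ (Set.range fun i => gradAt x (H i))) < n) :
    ∃ (x₀ : Fin n → ℝ) (E : Set (Fin n → ℝ)), eval x₀ (H i₀) = c ∧ E.Infinite ∧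
      (∀ x ∈ E, ∀ i, eval x (H i) = eval x₀ (H i)) ∧
      (∀ f g : MvPolynomial (Fin n) ℂ, (∀ x ∈ E, eval (fun i => (x i : ℂ)) (f * g) = 0) →
        (∀ x ∈ E, eval (fun i => (x i : ℂ)) f = 0) ∨ ∀ x ∈ E, eval (fun i => (x i : ℂ)) g = 0) ∧
      ∀ P : Ideal (MvPolynomial (Fin n) ℂ), P.IsPrime →
        (∀ i, map Complex.ofRealHom (H i) - C ((eval x₀ (H i) : ℝ) : ℂ) ∈ P) →
        (∀ f ∈ P, ∀ x ∈ E, eval (fun i => (x i : ℂ)) f = 0) →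
        ∀ f, (∀ x ∈ E, eval (fun i => (x i : ℂ)) f = 0) → f ∈ P := by
  classical
  obtain ⟨x₀, hx₀, e, hli, ⟨k₀, hk₀⟩, ⟨k₁, j₁, hk₁⟩, hspan⟩ :=
    exists_coordinates_of_maximal_rank H i₀ c hne hgrad hrank
  set Q : Fin n → MvPolynomial (Fin n) ℝ := fun k => withCoordinates H (e k) with hQ
  obtain ⟨Ψ, ε, hε, hΨ0, hΨan, hΨ⟩ := exists_analytic_localInverse Q x₀ hli
  set y₀ : Fin n → ℝ := fun k => eval x₀ (Q k) with hy₀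
  set B := Metric.ball y₀ ε with hB
  -- `mask` freezes the coordinates `k` for which `Q k` belongs to the family `H`
  let mask : (Fin n → ℝ) → (Fin n → ℝ) := fun s k => if (e k).isLeft then y₀ k else s k
  have hmask_an : AnalyticOnNhd ℝ mask B := by
    intro s _
    refine AnalyticAt.pi fun k => ?_
    by_cases h : (e k).isLeft
    · simpa [mask, h] using analyticAt_const
    · simp only [h]
      exact (ContinuousLinearMap.proj (R := ℝ) (φ := fun _ : Fin n => ℝ) k).analyticAt s
  have hmask : Set.MapsTo mask B B := by
    intro s hs
    rw [hB, Metric.mem_ball, dist_pi_lt_iff hε] at hs ⊢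
    intro k
    by_cases h : (e k).isLeft
    · simpa [mask, h] using hε
    · simpa [mask, h] using hs k
  have hmask0 : mask y₀ = y₀ := by
    ext k
    simp [mask]
  have hy₀B : y₀ ∈ B := Metric.mem_ball_self hε
  set φ : (Fin n → ℝ) → (Fin n → ℝ) := fun s => Ψ (mask s) with hφ
  have hφan : AnalyticOnNhd ℝ φ B := hΨan.comp hmask_an hmask
  have hφ0 : φ y₀ = x₀ := by simp only [hφ, hmask0, hΨ0]
  have hφQ (s) (hs : s ∈ B) (k) : eval (φ s) (Q k) = mask s k := (hΨ _ (hmask hs)).1 k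
  have hφH (s) (hs : s ∈ B) (k i) (hk : e k = Sum.inl i) : eval (φ s) (H i) = eval x₀ (H i) := by
    have h := hφQ s hs k
    simpa [mask, hQ, hy₀, hk, withCoordinates] using h
  have hBopen : IsOpen B := Metric.isOpen_ball
  have hBconn : IsPreconnected B := (convex_ball y₀ ε).isPreconnected
  -- the remaining members of `H` have zero derivative along `φ`
  have hconst (s) (hs : s ∈ B) (i) : eval (φ s) (H i) = eval x₀ (H i) := by
    have hd (p : MvPolynomial (Fin n) ℝ) (s) (hs : s ∈ B) :
        HasFDerivAt (fun s => eval (φ s) p)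
          ((dotProductCLM (gradAt (φ s) p)).comp (fderiv ℝ φ s)) s :=
      (hasFDerivAt_eval p (φ s)).comp s (hφan s hs).differentiableAt.hasFDerivAt
    have hzero (s) (hs : s ∈ B) :
        (dotProductCLM (gradAt (φ s) (H i))).comp (fderiv ℝ φ s) = 0 := by
      have hmem := hspan (φ s) ((hφH s hs k₀ i₀ hk₀).trans hx₀) (hΨ _ (hmask hs)).2 i
      refine Submodule.span_induction (p := fun v _ => (dotProductCLM v).comp (fderiv ℝ φ s) = 0)
        ?_ (by simp) (fun u v _ _ hu hv => by simp [ContinuousLinearMap.add_comp, hu, hv])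
        (fun r v _ hv => by simp [ContinuousLinearMap.smul_comp, hv]) hmem
      rintro _ ⟨⟨k, j, hk⟩, rfl⟩
      have h0 : HasFDerivAt (fun s => eval (φ s) (H j)) (0 : (Fin n → ℝ) →L[ℝ] ℝ) s := by
        refine (hasFDerivAt_const (eval x₀ (H j)) s).congr_of_eventuallyEq ?_
        filter_upwards [hBopen.mem_nhds hs] with t ht using hφH t ht k j hk
      have := (hd (H j) s hs).unique h0
      simpa [hk, withCoordinates] using this
    have := hBopen.is_const_of_fderiv_eq_zero (𝕜 := ℝ) hBconn
      (f := fun s => eval (φ s) (H i))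
      (fun s hs => (hd (H i) s hs).differentiableAt.differentiableWithinAt)
      (fun s hs => (hd (H i) s hs).fderiv.trans (hzero s hs)) hs hy₀B
    simpa [hφ0] using this
  refine ⟨x₀, φ '' B, hx₀, ?_, ?_, ?_, ?_⟩
  · -- the free coordinate takes infinitely many values
    refine Set.Infinite.of_image (fun x => x j₁) ((Set.Ioo_infinite (a := y₀ k₁ - ε)
      (b := y₀ k₁ + ε) (by linarith)).mono ?_)
    intro t ht
    have hs : Function.update y₀ k₁ t ∈ B := by
      rw [hB, Metric.mem_ball, dist_pi_lt_iff hε]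
      intro k
      by_cases h : k = k₁
      · subst h
        rw [Function.update_self, Real.dist_eq, abs_lt]
        constructor <;> linarith [ht.1, ht.2]
      · simpa [h] using hε
    refine ⟨_, ⟨_, hs, rfl⟩, ?_⟩
    have h := hφQ _ hs k₁
    simpa [mask, hQ, hk₁, withCoordinates] using h
  · rintro _ ⟨s, hs, rfl⟩ i
    exact hconst s hs i
  · intro f g hfg
    have han (p : MvPolynomial (Fin n) ℂ) :
        AnalyticOnNhd ℝ (fun s => eval (fun i => (φ s i : ℂ)) p) B := by
      intro s hs
      have := AnalyticAt.aeval_mvPolynomial (𝕜 := ℝ) (A := ℂ) (B := ℂ) (z := s)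
        (f := fun s i => (φ s i : ℂ)) (fun i => ?_) p
      · simpa [aeval_eq_eval] using this
      · exact (Complex.ofRealCLM.analyticAt _).comp ((analyticAt_pi_iff.mp (hφan s hs)) i)
    have := AnalyticOnNhd.eqOn_zero_or_eqOn_zero_of_mul hBopen hBconn (han f) (han g)
      fun s hs => by simpa using hfg _ ⟨s, hs, rfl⟩
    simpa using this
  · intro P hP hPH hPE f hf
    by_contra hfP
    set Q' : Fin n → MvPolynomial (Fin n) ℂ := fun k => map Complex.ofRealHom (Q k) with hQ'
    have hdet : (Matrix.of fun k i => pderiv i (Q' k)).det ∉ P := by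
      intro hmem
      have h := hPE _ hmem x₀ ⟨y₀, hy₀B, hφ0⟩
      have hM : (Matrix.of fun k i => pderiv i (Q' k)).map (eval fun i => (x₀ i : ℂ)) =
          (Matrix.of fun k => gradAt x₀ (Q k)).map Complex.ofRealHom := by
        ext k i
        simp only [Matrix.map_apply, Matrix.of_apply, hQ', pderiv_map, gradAt_apply]
        exact eval_ofReal_map _ _
      rw [RingHom.map_det, RingHom.mapMatrix_apply, hM, ← RingHom.mapMatrix_apply,
        ← RingHom.map_det, map_eq_zero] at h
      have hunit : IsUnit (Matrix.of fun k => gradAt x₀ (Q k)) :=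
        Matrix.linearIndependent_rows_iff_isUnit.mp hli
      exact ((Matrix.isUnit_iff_isUnit_det _).mp hunit).ne_zero h
    obtain ⟨a, haP, ha⟩ := exists_aeval_mem_of_jacobian_notMem P Q' hdet hfP
    have haE (s) (hs : s ∈ B) : eval (fun k => (mask s k : ℂ)) a = 0 := by
      have hle : P ⊔ Ideal.span {f} ≤ RingHom.ker (eval fun i => (φ s i : ℂ)) := by
        rw [sup_le_iff, Ideal.span_singleton_le_iff_mem]
        exact ⟨fun g hg => hPE g hg _ ⟨s, hs, rfl⟩, hf _ ⟨s, hs, rfl⟩⟩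
      have h := hle ha
      rw [RingHom.mem_ker, eval_aeval_eq] at h
      simpa only [hQ', eval_ofReal_map, hφQ s hs] using h
    -- substituting the constant values in `a` gives a polynomial that vanishes on a box
    set τ : Fin n → MvPolynomial (Fin n) ℂ := fun k => if (e k).isLeft then C (y₀ k : ℂ) else X k
      with hτ
    have hb : aeval τ a = 0 := by
      refine funext_set (fun k => Complex.ofReal '' Set.Ioo (y₀ k - ε) (y₀ k + ε))
        (fun k => (Set.Ioo_infinite (by linarith)).image Complex.ofReal_injective.injOn) ?_
      intro x hx
      choose s hs hsx using fun k => hx k (Set.mem_univ k)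
      obtain rfl : (fun k => (s k : ℂ)) = x := funext hsx
      have hsB : s ∈ B := by
        rw [hB, Metric.mem_ball, dist_pi_lt_iff hε]
        intro k
        rw [Real.dist_eq, abs_lt]
        constructor <;> linarith [(hs k).1, (hs k).2]
      rw [map_zero, ← haE s hsB, eval_aeval_eq]
      have hτs (k) : eval (fun k => (s k : ℂ)) (τ k) = (mask s k : ℂ) := by
        by_cases h : (e k).isLeft <;> simp [hτ, mask, h]
      simp only [hτs]
    have hτP (k) : Ideal.Quotient.mkₐ ℂ P (aeval Q' (τ k)) = Ideal.Quotient.mkₐ ℂ P (Q' k) := by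
      rcases hk : e k with i | j
      · have h := Ideal.Quotient.eq_zero_iff_mem.mpr (hPH i)
        rw [map_sub, sub_eq_zero] at h
        simpa only [hτ, hk, hQ', hQ, hy₀, withCoordinates, Sum.isLeft_inl, if_true, Sum.elim_inl,
          aeval_C, algebraMap_eq, Ideal.Quotient.mkₐ_eq_mk] using h.symm
      · simp [hτ, hk]
    have : Ideal.Quotient.mkₐ ℂ P (aeval Q' a) = Ideal.Quotient.mkₐ ℂ P (aeval Q' (aeval τ a)) := by
      have : (Ideal.Quotient.mkₐ ℂ P).comp (aeval Q') =
          (Ideal.Quotient.mkₐ ℂ P).comp ((aeval Q').comp (aeval τ)) := by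
        ext k
        simpa using (hτP k).symm
      exact DFunLike.congr_fun this a
    rw [hb, map_zero, map_zero] at this
    exact haP (Ideal.Quotient.eq_zero_iff_mem.mp this)

/-! ### The Zariski topology and the half-turn chart -/

open MvPolynomial in
theorem MvPolynomial.IsHomogeneous.eval_smul_point {σ R : Type*} [CommSemiring R]
    {f : MvPolynomial σ R} {n : ℕ} (hf : f.IsHomogeneous n) (a : R) (v : σ → R) :
    eval (a • v) f = a ^ n * eval v f := by
  rw [eval_eq, eval_eq, Finset.mul_sum]
  refine Finset.sum_congr rfl fun d hd => ?_
  have hdeg : ∑ i ∈ d.support, d i = n := by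
    have := hf (mem_support_iff.mp hd)
    simpa [Finsupp.weight_apply, Finsupp.sum] using this
  simp only [Pi.smul_apply, smul_eq_mul, mul_pow, Finset.prod_mul_distrib,
    Finset.prod_pow_eq_pow_sum, hdeg]
  ring

theorem exists_rep_mk_eq_smul {v : IsoCoord → ℂ} (hv : v ≠ 0) :
    ∃ a : ℂ, a ≠ 0 ∧ (Projectivization.mk ℂ v hv).rep = a • v := by
  obtain ⟨a, ha⟩ := Projectivization.exists_smul_eq_mk_rep ℂ v hv
  exact ⟨a, a.ne_zero, ha.symm⟩

open MvPolynomial in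
theorem eval_rep_mk_ne_zero_iff {f : MvPolynomial IsoCoord ℂ} {n : ℕ} (hf : f.IsHomogeneous n)
    {v : IsoCoord → ℂ} (hv : v ≠ 0) :
    eval (Projectivization.mk ℂ v hv).rep f ≠ 0 ↔ eval v f ≠ 0 := by
  obtain ⟨a, ha, h⟩ := exists_rep_mk_eq_smul hv
  rw [h, hf.eval_smul_point]
  simp [ha]

open MvPolynomial in
theorem isTopologicalBasis_zariski : TopologicalSpace.IsTopologicalBasis
    {U : Set IsoSpace | ∃ (n : ℕ) (f : MvPolynomial IsoCoord ℂ), f.IsHomogeneous n ∧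
      U = {p : IsoSpace | eval p.rep f ≠ 0}} where
  exists_subset_inter := by
    rintro _ ⟨n, f, hf, rfl⟩ _ ⟨m, g, hg, rfl⟩ p ⟨hpf, hpg⟩
    refine ⟨_, ⟨n + m, f * g, hf.mul hg, rfl⟩, ?_, ?_⟩
    · simpa using ⟨hpf, hpg⟩
    · intro q hq
      simpa [not_or] using hq
  sUnion_eq := Set.eq_univ_of_forall fun p =>
    ⟨_, ⟨0, 1, isHomogeneous_one _ _, rfl⟩, by simp⟩
  eq_generateFrom := rfl

open MvPolynomial in
theorem isOpen_eval_rep_ne_zero {n : ℕ} {f : MvPolynomial IsoCoord ℂ} (hf : f.IsHomogeneous n) :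
    IsOpen {p : IsoSpace | eval p.rep f ≠ 0} :=
  isTopologicalBasis_zariski.isOpen ⟨n, f, hf, rfl⟩

open MvPolynomial in
theorem mem_closure_zariski_iff {S : Set IsoSpace} {p : IsoSpace} :
    p ∈ closure S ↔ ∀ (n : ℕ) (f : MvPolynomial IsoCoord ℂ), f.IsHomogeneous n →
      eval p.rep f ≠ 0 → ∃ q ∈ S, eval q.rep f ≠ 0 := by
  rw [isTopologicalBasis_zariski.mem_closure_iff]
  constructor
  · intro h n f hf hp
    obtain ⟨q, hq, hqS⟩ := h _ ⟨n, f, hf, rfl⟩ hp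
    exact ⟨q, hqS, hq⟩
  · rintro h _ ⟨n, f, hf, rfl⟩ hp
    obtain ⟨q, hqS, hq⟩ := h n f hf hp
    exact ⟨q, hq, hqS⟩

open MvPolynomial in
theorem isPreirreducible_zariski_of {S : Set IsoSpace}
    (h : ∀ (n m : ℕ) (f g : MvPolynomial IsoCoord ℂ), f.IsHomogeneous n → g.IsHomogeneous m →
      (∃ p ∈ S, eval p.rep f ≠ 0) → (∃ p ∈ S, eval p.rep g ≠ 0) →
      ∃ p ∈ S, eval p.rep (f * g) ≠ 0) : IsPreirreducible S := by
  rintro u v hu hv ⟨p, hpS, hpu⟩ ⟨q, hqS, hqv⟩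
  obtain ⟨_, ⟨n, f, hf, rfl⟩, hpf, hfu⟩ :=
    isTopologicalBasis_zariski.exists_subset_of_mem_open hpu hu
  obtain ⟨_, ⟨m, g, hg, rfl⟩, hqg, hgv⟩ :=
    isTopologicalBasis_zariski.exists_subset_of_mem_open hqv hv
  obtain ⟨r, hrS, hr⟩ := h n m f g hf hg ⟨p, hpS, hpf⟩ ⟨q, hqS, hqg⟩
  rw [map_mul] at hr
  exact ⟨r, hrS, hfu (left_ne_zero_of_mul hr), hgv (right_ne_zero_of_mul hr)⟩

open MvPolynomial in
theorem IsPreirreducible.exists_eval_mul_ne_zero {T : Set IsoSpace} (hT : IsPreirreducible T)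
    {n m : ℕ} {f g : MvPolynomial IsoCoord ℂ} (hf : f.IsHomogeneous n) (hg : g.IsHomogeneous m)
    (hfT : ∃ p ∈ T, eval p.rep f ≠ 0) (hgT : ∃ p ∈ T, eval p.rep g ≠ 0) :
    ∃ p ∈ T, eval p.rep f ≠ 0 ∧ eval p.rep g ≠ 0 :=
  hT _ _ (isOpen_eval_rep_ne_zero hf) (isOpen_eval_rep_ne_zero hg) hfT hgT

/-- The direction vector `(a, b, 1)` of the axis of the half-turn with parameters `(a, b, c, d, s)`.
-/
def axisDir {R : Type*} [CommRing R] (z : Fin 5 → R) : Fin 3 → R := ![z 0, z 1, 1]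

/-- The vector `(c, d, -(ac + bd))`, orthogonal to the axis direction `(a, b, 1)`. -/
def axisFoot {R : Type*} [CommRing R] (z : Fin 5 → R) : Fin 3 → R :=
  ![z 2, z 3, -(z 0 * z 2 + z 1 * z 3)]

/-- The coordinates of the half-turn with parameters `z = (a, b, c, d, s)`, where `s (a² + b² + 1) =
1`: with `u = (a, b, 1)` its matrix is `2 s u uᵗ - 1`. -/
def halfTurn {R : Type*} [CommRing R] (z : Fin 5 → R) : IsoCoord → R
  | .h => 1
  | .m i j => 2 * z 4 * (axisDir z i * axisDir z j) - (1 : Matrix (Fin 3) (Fin 3) R) i j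
  | .x i => axisFoot z i
  | .y i => axisFoot z i
  | .r => axisFoot z ⬝ᵥ axisFoot z

/-- The parameters of a half-turn, as functions of its homogeneous coordinates. They are
meaningful where `h (m₃₃ + h) ≠ 0`; elsewhere some quotients take the value `0` by convention. -/
noncomputable def chart (v : IsoCoord → ℂ) : Fin 5 → ℂ :=
  ![v (.m 0 2) / (v (.m 2 2) + v .h), v (.m 1 2) / (v (.m 2 2) + v .h), v (.x 0) / v .h,
    v (.x 1) / v .h, (v (.m 2 2) + v .h) / (2 * v .h)]

theorem map_axisDir {R S : Type*} [CommRing R] [CommRing S] (f : R →+* S) (z : Fin 5 → R)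
    (i : Fin 3) : f (axisDir z i) = axisDir (fun k => f (z k)) i := by
  fin_cases i <;> simp [axisDir]

theorem map_axisFoot {R S : Type*} [CommRing R] [CommRing S] (f : R →+* S) (z : Fin 5 → R)
    (i : Fin 3) : f (axisFoot z i) = axisFoot (fun k => f (z k)) i := by
  fin_cases i <;> simp [axisFoot]

theorem map_halfTurn {R S : Type*} [CommRing R] [CommRing S] (f : R →+* S) (z : Fin 5 → R)
    (c : IsoCoord) : f (halfTurn z c) = halfTurn (fun k => f (z k)) c := by
  cases c with
  | h => simp [halfTurn]
  | m i j => by_cases h : i = j <;> simp [halfTurn, map_axisDir, map_ofNat, Matrix.one_apply, h]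
  | x i => simp [halfTurn, map_axisFoot]
  | y i => simp [halfTurn, map_axisFoot]
  | r => simp [halfTurn, map_axisFoot, dotProduct]

theorem halfTurn_ne_zero {R : Type*} [CommRing R] [Nontrivial R] (z : Fin 5 → R) :
    halfTurn z ≠ 0 :=
  fun h => one_ne_zero (α := R) (congrFun h .h)

theorem IsoEquations.smul {v : IsoCoord → ℂ} (hv : IsoEquations v) (a : ℂ) :
    IsoEquations (a • v) := by
  have hM : matPart (a • v) = a • matPart v := rfl
  have hx : xPart (a • v) = a • xPart v := rfl
  have hy : yPart (a • v) = a • yPart v := rfl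
  constructor
  · rw [hM, Matrix.transpose_smul, Matrix.smul_mul, Matrix.mul_smul, hv.mul_transpose]
    simp only [Pi.smul_apply, smul_eq_mul, smul_smul]
    ring_nf
  · rw [hM, Matrix.transpose_smul, Matrix.smul_mul, Matrix.mul_smul, hv.transpose_mul]
    simp only [Pi.smul_apply, smul_eq_mul, smul_smul]
    ring_nf
  · rw [hM, Matrix.det_smul, hv.det_eq]
    simp only [Pi.smul_apply, smul_eq_mul, Fintype.card_fin]
    ring
  · have h := congrArg (a ^ 2 • ·) hv.transpose_mulVec
    simp only [smul_add, smul_zero, smul_smul] at h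
    rw [hM, hx, hy, Matrix.transpose_smul, Matrix.smul_mulVec, Matrix.mulVec_smul, ← h]
    simp only [Pi.smul_apply, smul_eq_mul, smul_smul]
    ring_nf
  · have h := congrArg (a ^ 2 • ·) hv.mulVec
    simp only [smul_add, smul_zero, smul_smul] at h
    rw [hM, hx, hy, Matrix.smul_mulVec, Matrix.mulVec_smul, ← h]
    simp only [Pi.smul_apply, smul_eq_mul, smul_smul]
    ring_nf
  · rw [hx, smul_dotProduct, dotProduct_smul, hv.x_sq]
    simp only [Pi.smul_apply, smul_eq_mul]
    ring
  · rw [hy, smul_dotProduct, dotProduct_smul, hv.y_sq]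
    simp only [Pi.smul_apply, smul_eq_mul]
    ring

theorem isoEquations_halfTurn {z : Fin 5 → ℂ} (hz : z 4 * (z 0 ^ 2 + z 1 ^ 2 + 1) = 1) :
    IsoEquations (halfTurn z) := by
  set u := axisDir z with hu
  have huu : z 4 * (u ⬝ᵥ u) = 1 := by
    have : u ⬝ᵥ u = z 0 ^ 2 + z 1 ^ 2 + 1 := by
      simp [hu, axisDir, dotProduct, Fin.sum_univ_three]
      ring
    rw [this, hz]
  have huf : u ⬝ᵥ axisFoot z = 0 := by
    simp [hu, axisDir, axisFoot, dotProduct, Fin.sum_univ_three]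
  have hM : matPart (halfTurn z) = (2 * z 4) • Matrix.vecMulVec u u - 1 := by
    ext i j
    simp [matPart, halfTurn, Matrix.vecMulVec_apply, hu]
  clear_value u
  have hMt : (matPart (halfTurn z))ᵀ = matPart (halfTurn z) := by
    rw [hM, Matrix.transpose_sub, Matrix.transpose_smul, Matrix.transpose_vecMulVec,
      Matrix.transpose_one]
  have hMM : matPart (halfTurn z) * matPart (halfTurn z) = 1 := by
    rw [hM, sub_mul, mul_sub, Matrix.smul_mul, Matrix.mul_smul, Matrix.vecMulVec_mul_vecMulVec]
    ext i j
    simp [Matrix.vecMulVec_apply]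
    linear_combination (4 * z 4 * u i * u j) * huu
  have hMx : matPart (halfTurn z) *ᵥ axisFoot z + axisFoot z = 0 := by
    rw [hM, Matrix.sub_mulVec, Matrix.smul_mulVec, Matrix.vecMulVec_mulVec, huf]
    simp
  constructor
  · rw [hMt, hMM]; simp [halfTurn]
  · rw [hMt, hMM]; simp [halfTurn]
  · rw [Matrix.det_fin_three]
    simp [matPart, halfTurn, axisDir]
    linear_combination 2 * hz
  · rw [hMt, ← hMx]
    simp [halfTurn]
    rfl
  · rw [← hMx]
    simp [halfTurn]
    rfl
  · simp [halfTurn, xPart, dotProduct]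
  · simp [halfTurn, yPart, dotProduct]

/-- The half-turn with parameters `z` as a point of `ℙ¹⁶`. -/
noncomputable def halfTurnPoint (z : Fin 5 → ℂ) : IsoSpace :=
  Projectivization.mk ℂ (halfTurn z) (halfTurn_ne_zero z)

theorem halfTurnPoint_mem_symSpace (z : Fin 5 → ℂ) : halfTurnPoint z ∈ symSpace := by
  obtain ⟨a, ha, h⟩ := exists_rep_mk_eq_smul (halfTurn_ne_zero z)
  constructor
  · ext i j
    simp [halfTurnPoint, h, matPart, halfTurn, mul_comm (axisDir z i), Matrix.one_apply, eq_comm]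
  · ext i
    simp [halfTurnPoint, h, xPart, yPart, halfTurn]

theorem halfTurnPoint_mem_invVariety {z : Fin 5 → ℂ}
    (hz : z 4 * (z 0 ^ 2 + z 1 ^ 2 + 1) = 1) : halfTurnPoint z ∈ invVariety := by
  obtain ⟨a, ha, h⟩ := exists_rep_mk_eq_smul (halfTurn_ne_zero z)
  refine ⟨?_, halfTurnPoint_mem_symSpace z, ?_⟩
  · change IsoEquations _
    rw [halfTurnPoint, h]
    exact (isoEquations_halfTurn hz).smul a
  · rw [halfTurnPoint, h, Matrix.trace_fin_three]
    simp [matPart, halfTurn, axisDir]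
    linear_combination (2 * a) * hz

theorem chart_smul {a : ℂ} (ha : a ≠ 0) (v : IsoCoord → ℂ) : chart (a • v) = chart v := by
  ext i
  fin_cases i <;> simp [chart, ← mul_add, mul_div_mul_left, ha, mul_left_comm (2 : ℂ)]

theorem chart_halfTurn {z : Fin 5 → ℂ} (hz : z 4 ≠ 0) : chart (halfTurn z) = z := by
  ext i
  fin_cases i <;> simp [chart, halfTurn, axisDir, axisFoot, hz]

/-- On the domain of `chart`, every point of `X_inv` is the half-turn with the parameters that
`chart` assigns to it. The matrix `M + h` satisfies `A² = 2 h A` and has trace `2 h`, so its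
adjugate vanishes and it has rank one. -/
theorem eq_smul_halfTurn_chart {v : IsoCoord → ℂ} (hv : IsoEquations v)
    (hsym : (matPart v)ᵀ = matPart v) (hxy : xPart v = yPart v)
    (htr : (matPart v).trace + v .h = 0) (hh : v .h ≠ 0) (hm : v (.m 2 2) + v .h ≠ 0) :
    v = v .h • halfTurn (chart v) ∧
      chart v 4 * (chart v 0 ^ 2 + chart v 1 ^ 2 + 1) = 1 := by
  have hs (i j : Fin 3) : v (.m j i) = v (.m i j) := congrFun (congrFun hsym i) j
  have h10 := hs 0 1
  have h20 := hs 0 2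
  have h21 := hs 1 2
  have hE (i j : Fin 3) : v (.m i 0) * v (.m j 0) + v (.m i 1) * v (.m j 1) +
      v (.m i 2) * v (.m j 2) - v .h ^ 2 * (1 : Matrix (Fin 3) (Fin 3) ℂ) i j = 0 := by
    have := congrFun (congrFun hv.mul_transpose i) j
    simpa [Matrix.mul_apply, Fin.sum_univ_three, matPart, sub_eq_zero] using this
  have h00 := hE 0 0
  have h01 := hE 0 1
  have h11 := hE 1 1
  have h22 := hE 2 2
  rw [Matrix.trace_fin_three] at htr
  simp only [matPart, Matrix.of_apply] at htr
  simp [h10, h20, h21] at h00 h01 h11 h22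
  -- the `2 × 2` minors of `M + h` vanish
  have m00 : (v (.m 0 0) + v .h) * (v (.m 2 2) + v .h) = v (.m 0 2) ^ 2 := by
    linear_combination h11 - htr * (v (.m 1 1) + v .h) +
      (htr * (v (.m 0 0) + v (.m 1 1) + v (.m 2 2) + 3 * v .h) - h00 - h11 - h22) / 2
  have m11 : (v (.m 1 1) + v .h) * (v (.m 2 2) + v .h) = v (.m 1 2) ^ 2 := by
    linear_combination h00 - htr * (v (.m 0 0) + v .h) +
      (htr * (v (.m 0 0) + v (.m 1 1) + v (.m 2 2) + 3 * v .h) - h00 - h11 - h22) / 2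
  have m01 : v (.m 0 1) * (v (.m 2 2) + v .h) = v (.m 0 2) * v (.m 1 2) := by
    linear_combination - h01 + htr * v (.m 0 1)
  have hx (i : Fin 3) : v (.y i) = v (.x i) := (congrFun hxy i).symm
  have hx2 : v (.m 0 2) * v (.x 0) + v (.m 1 2) * v (.x 1) +
      (v (.m 2 2) + v .h) * v (.x 2) = 0 := by
    have := congrFun hv.mulVec 2
    simp [Matrix.mulVec, dotProduct, Fin.sum_univ_three, matPart, xPart, yPart, hx, h20,
      h21] at this
    linear_combination this
  have hr := hv.x_sq
  simp [dotProduct, Fin.sum_univ_three, xPart] at hr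
  have hx2' : v (.x 2) = -(v (.m 0 2) * v (.x 0) + v (.m 1 2) * v (.x 1)) /
      (v (.m 2 2) + v .h) := by
    field_simp
    linear_combination hx2
  have hfoot (i : Fin 3) : v (.x i) = v .h * axisFoot (chart v) i := by
    fin_cases i
    · simp [axisFoot, chart]
      field_simp
    · simp [axisFoot, chart]
      field_simp
    · simp [axisFoot, chart]
      rw [hx2']
      field_simp
      ring
  constructor
  · ext c
    cases c with
    | h => simp [halfTurn]
    | m i j =>
      rw [Pi.smul_apply, smul_eq_mul]
      fin_cases i <;> fin_cases j <;> simp [halfTurn, chart, axisDir, h10, h20, h21] <;>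
        field_simp
      · linear_combination m00
      · linear_combination m01
      · linear_combination m01
      · linear_combination m11
      · ring
    | x i => simp [halfTurn, hfoot i]
    | y i => simp [halfTurn, hx, hfoot i]
    | r =>
      rw [Pi.smul_apply, smul_eq_mul]
      simp only [hfoot] at hr
      simp only [halfTurn, dotProduct, Fin.sum_univ_three]
      refine mul_right_cancel₀ hh ?_
      linear_combination -hr
  · simp [chart]
    field_simp
    linear_combination h22

/-! ### Homogenization along the chart and the sphere condition -/

/-- The quadratic form `h (m₃₃ + h)`, whose nonvanishing locus is the domain of `chart`. -/
noncomputable def chartDenom : MvPolynomial IsoCoord ℂ :=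
  MvPolynomial.X .h * (MvPolynomial.X (.m 2 2) + MvPolynomial.X .h)

theorem chartDenom_isHomogeneous : chartDenom.IsHomogeneous 2 :=
  (MvPolynomial.isHomogeneous_X _ _).mul
    ((MvPolynomial.isHomogeneous_X _ _).add (MvPolynomial.isHomogeneous_X _ _))

theorem eval_chartDenom (v : IsoCoord → ℂ) :
    MvPolynomial.eval v chartDenom = v .h * (v (.m 2 2) + v .h) := by
  simp [chartDenom]

open MvPolynomial in
theorem exists_chart_numerator (i : Fin 5) : ∃ G : MvPolynomial IsoCoord ℂ, G.IsHomogeneous 2 ∧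
    ∀ v, eval v chartDenom ≠ 0 → eval v G = eval v chartDenom * chart v i := by
  have hX (c : IsoCoord) : (X c : MvPolynomial IsoCoord ℂ).IsHomogeneous 1 := isHomogeneous_X ℂ c
  obtain ⟨N, hN, hNv⟩ : ∃ N : MvPolynomial IsoCoord ℂ, N.IsHomogeneous 1 ∧
      ∀ v, eval v N = v (.m 2 2) + v .h :=
    ⟨_, (hX (.m 2 2)).add (hX .h), fun v => by simp⟩
  have hmul {F G : MvPolynomial IsoCoord ℂ} (hF : F.IsHomogeneous 1) (hG : G.IsHomogeneous 1) :
      (F * G).IsHomogeneous 2 := hF.mul hG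
  simp only [eval_chartDenom]
  match i with
  | 0 =>
    refine ⟨X .h * X (.m 0 2), hmul (hX _) (hX _), fun v hv => ?_⟩
    have := right_ne_zero_of_mul hv
    simp only [chart, map_mul, eval_X, Matrix.cons_val]
    field_simp
  | 1 =>
    refine ⟨X .h * X (.m 1 2), hmul (hX _) (hX _), fun v hv => ?_⟩
    have := right_ne_zero_of_mul hv
    simp only [chart, map_mul, eval_X, Matrix.cons_val]
    field_simp
  | 2 =>
    refine ⟨X (.x 0) * N, hmul (hX _) hN, fun v hv => ?_⟩
    have := left_ne_zero_of_mul hv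
    simp only [chart, map_mul, eval_X, hNv, Matrix.cons_val]
    field_simp
  | 3 =>
    refine ⟨X (.x 1) * N, hmul (hX _) hN, fun v hv => ?_⟩
    have := left_ne_zero_of_mul hv
    simp only [chart, map_mul, eval_X, hNv, Matrix.cons_val]
    field_simp
  | 4 =>
    refine ⟨C (1 / 2) * (N * N), ?_, fun v hv => ?_⟩
    · have h := (isHomogeneous_C IsoCoord (1 / 2 : ℂ)).mul (hmul hN hN)
      rwa [zero_add] at h
    · have := left_ne_zero_of_mul hv
      simp only [chart, map_mul, hNv, eval_C, Matrix.cons_val]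
      field_simp

open MvPolynomial in
/-- A polynomial in the chart coordinates is, up to a power of `chartDenom`, a homogeneous
polynomial in the coordinates of `ℙ¹⁶`. -/
theorem exists_chart_homogenization (g : MvPolynomial (Fin 5) ℂ) :
    ∃ (n : ℕ) (G : MvPolynomial IsoCoord ℂ), G.IsHomogeneous (2 * n) ∧
      ∀ v, eval v chartDenom ≠ 0 → eval v G = eval v chartDenom ^ n * eval (chart v) g := by
  induction g using MvPolynomial.induction_on with
  | C a => exact ⟨0, C a, by simpa using isHomogeneous_C IsoCoord a, fun v _ => by simp⟩
  | add p q hp hq =>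
    obtain ⟨n, F, hF, hFv⟩ := hp
    obtain ⟨m, G, hG, hGv⟩ := hq
    refine ⟨n + m, F * chartDenom ^ m + G * chartDenom ^ n, ?_, fun v hv => ?_⟩
    · have h1 := hF.mul (chartDenom_isHomogeneous.pow m)
      have h2 := hG.mul (chartDenom_isHomogeneous.pow n)
      rw [← mul_add] at h1 h2
      rw [add_comm m n] at h2
      exact h1.add h2
    · simp only [map_add, map_mul, map_pow, hFv v hv, hGv v hv]
      ring
  | mul_X p i hp =>
    obtain ⟨n, F, hF, hFv⟩ := hp
    obtain ⟨G, hG, hGv⟩ := exists_chart_numerator i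
    refine ⟨n + 1, F * G, ?_, fun v hv => ?_⟩
    · simpa [mul_add] using hF.mul hG
    · simp only [map_mul, hFv v hv, hGv v hv, eval_X]
      ring

/-- The symmetric bilinear sphere condition without the term `l h`, over any commutative ring. -/
def legForm {R : Type*} [CommRing R] (g : Sym2 (Fin 4) → R) (v : IsoCoord → R) : R :=
  g s(0, 0) * v .r - 4 * ∑ i : Fin 3, g s(0, i.succ) * v (.x i)
    - 2 * ∑ i : Fin 3, g s(i.succ, i.succ) * v (.m i i)
    - 4 * ∑ i : Fin 3, ∑ j ∈ Finset.Ioi i, g s(i.succ, j.succ) * v (.m i j)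

theorem symSphereForm_eq (v : IsoCoord → ℂ) (w : SymLegL) :
    symSphereForm v w = w.1 * v .h + legForm w.2 v := by
  simp only [symSphereForm, legForm]
  ring

theorem map_legForm {R S : Type*} [CommRing R] [CommRing S] (f : R →+* S)
    (g : Sym2 (Fin 4) → R) (v : IsoCoord → R) :
    f (legForm g v) = legForm (fun q => f (g q)) (fun c => f (v c)) := by
  simp [legForm, map_ofNat]

theorem legForm_smul_right {R : Type*} [CommRing R] (g : Sym2 (Fin 4) → R) (a : R)
    (v : IsoCoord → R) : legForm g (a • v) = a * legForm g v := by
  simp only [legForm, Pi.smul_apply, smul_eq_mul, mul_left_comm _ a, ← Finset.mul_sum]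
  ring

theorem legForm_add_left {R : Type*} [CommRing R] (g g' : Sym2 (Fin 4) → R)
    (v : IsoCoord → R) : legForm (g + g') v = legForm g v + legForm g' v := by
  simp only [legForm, Pi.add_apply, add_mul, Finset.sum_add_distrib]
  ring

theorem legForm_smul_left {R : Type*} [CommRing R] (a : R) (g : Sym2 (Fin 4) → R)
    (v : IsoCoord → R) : legForm (a • g) v = a * legForm g v := by
  simp only [legForm, Pi.smul_apply, smul_eq_mul, mul_assoc a, ← Finset.mul_sum]
  ring

/-- The real polynomial in the parameters of a half-turn to which the form given by the real part of
`g` pulls back. -/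
noncomputable def legPoly : SymLeg →ₗ[ℝ] MvPolynomial (Fin 5) ℝ where
  toFun g := legForm (fun q => MvPolynomial.C (g q).re) (halfTurn MvPolynomial.X)
  map_add' g g' := by
    rw [← legForm_add_left]
    exact congrArg (legForm · _) (funext fun q => by simp)
  map_smul' a g := by
    rw [RingHom.id_apply, MvPolynomial.smul_eq_C_mul, ← legForm_smul_left]
    exact congrArg (legForm · _) (funext fun q => by simp)

theorem legPoly_apply (g : SymLeg) :
    legPoly g = legForm (fun q => MvPolynomial.C (g q).re) (halfTurn MvPolynomial.X) := rfl

open MvPolynomial in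
theorem eval_legPoly (g : SymLeg) (x : Fin 5 → ℝ) :
    eval x (legPoly g) = legForm (fun q => (g q).re) (halfTurn x) := by
  rw [legPoly_apply, map_legForm]
  simp only [eval_C, map_halfTurn, eval_X]

open MvPolynomial in
theorem eval_map_legPoly {g : SymLeg} (hg : star g = g) (z : Fin 5 → ℂ) :
    eval z (map Complex.ofRealHom (legPoly g)) = legForm g (halfTurn z) := by
  have hre (q) : ((g q).re : ℂ) = g q := Complex.conj_eq_iff_re.mp (congrFun hg q)
  rw [legPoly_apply, map_legForm, map_legForm]
  simp only [map_C, eval_C, map_halfTurn, map_X, eval_X, Complex.ofRealHom_eq_coe, hre]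

theorem legForm_halfTurn_ofReal {g : SymLeg} (hg : star g = g) (x : Fin 5 → ℝ) :
    legForm g (halfTurn fun k => (x k : ℂ)) = (MvPolynomial.eval x (legPoly g) : ℝ) := by
  rw [← eval_map_legPoly hg, eval_ofReal_map]

theorem eval_legPoly_pE (x : Fin 5 → ℝ) :
    MvPolynomial.eval x (legPoly (projL pE)) = 6 - 4 * (x 4 * (x 0 ^ 2 + x 1 ^ 2 + 1)) := by
  have h00 : (projL pE) s(0, 0) = 0 := by simp [projL, pE]
  have h0 (i : Fin 3) : (projL pE) s(0, i.succ) = 0 := by fin_cases i <;> simp [projL, pE]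
  have hii (i : Fin 3) : (projL pE) s(i.succ, i.succ) = 1 := by fin_cases i <;> simp [projL, pE]
  have hij (i j : Fin 3) (h : i ≠ j) : (projL pE) s(i.succ, j.succ) = 0 := by
    fin_cases i <;> fin_cases j <;> simp [projL, pE] at h ⊢
  have hlast : ∑ i : Fin 3, ∑ j ∈ Finset.Ioi i, ((projL pE) s(i.succ, j.succ)).re *
      halfTurn x (.m i j) = 0 :=
    Finset.sum_eq_zero fun i _ => Finset.sum_eq_zero fun j hj => by
      rw [hij i j (Finset.mem_Ioi.mp hj).ne, Complex.zero_re, zero_mul]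
  rw [eval_legPoly, legForm, hlast]
  simp only [h00, h0, hii, Complex.zero_re, Complex.one_re, zero_mul, one_mul,
    Fin.sum_univ_three, halfTurn, axisDir, Matrix.one_apply_eq, Matrix.cons_val]
  ring

open MvPolynomial in
/-- The derivative in the direction of `s` is `-4 (a² + b² + 1)`, nonzero at real points. -/
theorem gradAt_legPoly_pE_ne_zero (x : Fin 5 → ℝ) : gradAt x (legPoly (projL pE)) ≠ 0 := by
  have hpoly : legPoly (projL pE) = C 6 - C 4 * (X 4 * (X 0 ^ 2 + X 1 ^ 2 + 1)) :=
    funext fun y => by simp [eval_legPoly_pE]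
  intro h
  have h4 := congrFun h 4
  rw [gradAt_apply, hpoly] at h4
  simp [Derivation.leibniz] at h4
  have : 0 < x 0 ^ 2 + x 1 ^ 2 + 1 := by positivity
  exact this.ne' h4

/-- The real points of a complex linear subspace. -/
def realSubmodule (G : Submodule ℂ SymLeg) : Submodule ℝ SymLeg where
  carrier := {g | g ∈ G ∧ star g = g}
  add_mem' := fun ⟨h1, h2⟩ ⟨h3, h4⟩ => ⟨G.add_mem h1 h3, by rw [star_add, h2, h4]⟩
  zero_mem' := ⟨G.zero_mem, star_zero _⟩
  smul_mem' := fun r g ⟨h1, h2⟩ => ⟨G.smul_of_tower_mem r h1, by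
    rw [star_smul, h2, star_trivial]⟩

/-- A real subspace and its multiple by `i` are independent over `ℝ`. -/
theorem finrank_realSubmodule_le (G : Submodule ℂ SymLeg) :
    Module.finrank ℝ (realSubmodule G) ≤ Module.finrank ℂ G := by
  let f : realSubmodule G × realSubmodule G →ₗ[ℝ] G :=
    { toFun p := ⟨p.1.1 + Complex.I • p.2.1, G.add_mem p.1.2.1 (G.smul_mem _ p.2.2.1)⟩
      map_add' p q := by ext1; simp; abel
      map_smul' r p := by ext1; simp [smul_comm Complex.I r] }
  have hf : Function.Injective f := by
    rw [← LinearMap.ker_eq_bot, LinearMap.ker_eq_bot']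
    rintro ⟨⟨a, haG, ha⟩, ⟨b, hbG, hb⟩⟩ h
    have h' : a + Complex.I • b = 0 := congrArg Subtype.val h
    have hq (q) : a q = 0 ∧ b q = 0 := by
      have h1 := congrFun h' q
      have ha' := Complex.conj_eq_iff_im.mp (congrFun ha q)
      have hb' := Complex.conj_eq_iff_im.mp (congrFun hb q)
      have hre := congrArg Complex.re h1
      have him := congrArg Complex.im h1
      simp [ha', hb'] at hre him
      exact ⟨Complex.ext hre ha', Complex.ext him hb'⟩
    ext q
    · exact (hq q).1
    · exact (hq q).2
  have h := LinearMap.finrank_le_finrank_of_injective hf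
  rw [Module.finrank_prod, finrank_real_of_complex] at h
  omega

theorem exists_real_decomposition {G : Submodule ℂ SymLeg} (hG : IsDefinedOverReals G)
    {g : SymLeg} (hg : g ∈ G) :
    ∃ a ∈ realSubmodule G, ∃ b ∈ realSubmodule G, g = a + Complex.I • b := by
  refine ⟨(1 / 2 : ℂ) • (g + star g), ⟨G.smul_mem _ (G.add_mem hg (hG g hg)), ?_⟩,
    (-Complex.I / 2) • (g - star g), ⟨G.smul_mem _ (G.sub_mem hg (hG g hg)), ?_⟩, ?_⟩
  · simp [add_comm]
  · ext q
    simp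
    ring
  · ext q
    simp
    linear_combination (1 / 2 * (g q - (starRingEnd ℂ) (g q))) * Complex.I_sq

/-! ### Lifts of Borel subspaces -/

/-- The half-turn with real parameters `x`, as a point of `ℙ¹⁶`. -/
noncomputable def realHalfTurnPoint (x : Fin 5 → ℝ) : IsoSpace :=
  halfTurnPoint fun k => (x k : ℂ)

theorem realHalfTurnPoint_mem_realPoints (x : Fin 5 → ℝ) : realHalfTurnPoint x ∈ realPoints := by
  refine ⟨_, _, fun c => ?_, rfl⟩
  have h := map_halfTurn Complex.ofRealHom x c
  simp only [Complex.ofRealHom_eq_coe] at h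
  rw [← h, Complex.ofReal_im]

open MvPolynomial in
theorem eval_rep_realHalfTurnPoint_ne_zero_iff {f : MvPolynomial IsoCoord ℂ} {n : ℕ}
    (hf : f.IsHomogeneous n) (x : Fin 5 → ℝ) :
    eval (realHalfTurnPoint x).rep f ≠ 0 ↔
      eval (fun k => (x k : ℂ)) (aeval (halfTurn X) f) ≠ 0 := by
  rw [realHalfTurnPoint, halfTurnPoint, eval_rep_mk_ne_zero_iff hf, eval_aeval_eq]
  simp only [map_halfTurn, eval_X]

theorem chart_rep_halfTurnPoint {z : Fin 5 → ℂ} (hz : z 4 ≠ 0) :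
    chart (halfTurnPoint z).rep = z := by
  obtain ⟨a, ha, h⟩ := exists_rep_mk_eq_smul (halfTurn_ne_zero z)
  rw [halfTurnPoint, h, chart_smul ha, chart_halfTurn hz]

theorem eval_chartDenom_rep_halfTurnPoint {z : Fin 5 → ℂ} (hz : z 4 ≠ 0) :
    MvPolynomial.eval (halfTurnPoint z).rep chartDenom ≠ 0 := by
  rw [halfTurnPoint, eval_rep_mk_ne_zero_iff chartDenom_isHomogeneous, eval_chartDenom]
  simpa [halfTurn, axisDir] using hz

open MvPolynomial in
/-- The polynomials that vanish on the chart image of a preirreducible set form a prime ideal. -/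
theorem exists_isPrime_chart_vanishing {T : Set IsoSpace} (hT : IsPreirreducible T)
    (hTD : ∃ p ∈ T, eval p.rep chartDenom ≠ 0) :
    ∃ P : Ideal (MvPolynomial (Fin 5) ℂ), P.IsPrime ∧
      ∀ g, g ∈ P ↔ ∀ p ∈ T, eval p.rep chartDenom ≠ 0 → eval (chart p.rep) g = 0 := by
  let P : Ideal (MvPolynomial (Fin 5) ℂ) :=
    { carrier := {g | ∀ p ∈ T, eval p.rep chartDenom ≠ 0 → eval (chart p.rep) g = 0}
      add_mem' := fun hf hg p hp hD => by rw [map_add, hf p hp hD, hg p hp hD, add_zero]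
      zero_mem' := fun p _ _ => map_zero _
      smul_mem' := fun f g hg p hp hD => by rw [smul_eq_mul, map_mul, hg p hp hD, mul_zero] }
  refine ⟨P, ⟨?_, ?_⟩, fun g => Iff.rfl⟩
  · obtain ⟨p, hp, hD⟩ := hTD
    rw [Ideal.ne_top_iff_one]
    intro h
    have := h p hp hD
    simp at this
  · intro f g hfg
    by_contra! hcon
    obtain ⟨hf, hg⟩ := hcon
    have key (f : MvPolynomial (Fin 5) ℂ) (hf : f ∉ P) :
        ∃ (n : ℕ) (F : MvPolynomial IsoCoord ℂ), F.IsHomogeneous n ∧ (∃ p ∈ T, eval p.rep F ≠ 0) ∧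
          ∀ v, eval v F ≠ 0 → eval v chartDenom ≠ 0 ∧ eval (chart v) f ≠ 0 := by
      obtain ⟨n, F, hF, hFv⟩ := exists_chart_homogenization f
      have hf' : ¬ ∀ p ∈ T, eval p.rep chartDenom ≠ 0 → eval (chart p.rep) f = 0 := hf
      push Not at hf'
      obtain ⟨p, hp, hD, hpf⟩ := hf'
      refine ⟨_, F * chartDenom, hF.mul chartDenom_isHomogeneous, ⟨p, hp, ?_⟩, fun v hv => ?_⟩
      · rw [map_mul, hFv _ hD]
        exact mul_ne_zero (mul_ne_zero (pow_ne_zero _ hD) hpf) hD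
      · rw [map_mul] at hv
        have hD := right_ne_zero_of_mul hv
        have h := left_ne_zero_of_mul hv
        rw [hFv _ hD] at h
        exact ⟨hD, right_ne_zero_of_mul h⟩
    obtain ⟨n, F, hF, hFT, hFv⟩ := key f hf
    obtain ⟨m, G, hG, hGT, hGv⟩ := key g hg
    obtain ⟨p, hp, hpF, hpG⟩ := hT.exists_eval_mul_ne_zero hF hG hFT hGT
    have h := hfg p hp (hFv _ hpF).1
    rw [map_mul] at h
    exact mul_ne_zero (hFv _ hpF).2 (hGv _ hpG).2 h

/-- The linear lift `g ↦ (l, g)` with `l = -legForm g v`, the value of `l` for which the leg is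
orthogonal to the point `v` with `h = 1`. -/
def legLift (v : IsoCoord → ℂ) : SymLeg →ₗ[ℂ] SymLegL :=
  LinearMap.prod
    { toFun := fun g => -legForm g v
      map_add' := fun g g' => by rw [legForm_add_left]; ring
      map_smul' := fun a g => by
        rw [legForm_smul_left, RingHom.id_apply, smul_eq_mul, mul_neg] }
    LinearMap.id

theorem legLift_apply (v : IsoCoord → ℂ) (g : SymLeg) : legLift v g = (-legForm g v, g) := rfl

theorem symSphereForm_legLift (v w : IsoCoord → ℂ) (g : SymLeg) :
    symSphereForm w (legLift v g) = legForm g w - legForm g v * w .h := by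
  rw [symSphereForm_eq, legLift_apply]
  ring

theorem star_legLift (x : Fin 5 → ℝ) (g : SymLeg) :
    star (legLift (halfTurn fun k => (x k : ℂ)) g) =
      legLift (halfTurn fun k => (x k : ℂ)) (star g) := by
  rw [legLift_apply, legLift_apply, Prod.star_def]
  refine Prod.ext ?_ rfl
  change starRingEnd ℂ _ = _
  rw [map_neg, map_legForm]
  simp only [map_halfTurn, Complex.conj_ofReal]
  rfl

theorem star_projL_pE : star (projL pE) = projL pE := by
  ext q
  simp only [projL, pE, LinearMap.snd_apply, Pi.star_apply]
  split_ifs <;> simp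

open MvPolynomial in
/-- For a suitable real half-turn, the dual of the lift of a Borel subspace that is orthogonal to it
meets `X_inv` in a set with a real component. The first condition says that the lift contains
`p_e`. -/
theorem exists_halfTurn_hasRealComponent {G : Submodule ℂ SymLeg} (hG : IsBorelSubspace G)
    (hGreal : IsDefinedOverReals G) :
    ∃ x₀ : Fin 5 → ℝ, legForm (projL pE) (halfTurn fun k => (x₀ k : ℂ)) = 2 ∧
      HasRealComponent
        (invVariety ∩ dualInS (G.map (legLift (halfTurn fun k => (x₀ k : ℂ))))) := by
  obtain ⟨hG4, hGe⟩ := hG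
  let H : realSubmodule G → MvPolynomial (Fin 5) ℝ := fun g => legPoly g
  have hrank (x : Fin 5 → ℝ) :
      Module.finrank ℝ (Submodule.span ℝ (Set.range fun g => gradAt x (H g))) < 5 := by
    let L : realSubmodule G →ₗ[ℝ] (Fin 5 → ℝ) :=
      (gradAt x).comp (legPoly.comp (realSubmodule G).subtype)
    have hspan : Submodule.span ℝ (Set.range fun g => gradAt x (H g)) = LinearMap.range L :=
      (LinearMap.range L).span_eq
    rw [hspan]
    have h1 := L.finrank_range_le
    have h2 := finrank_realSubmodule_le G
    omega
  obtain ⟨x₀, E, hx₀, hEinf, hEH, hEirr, hEdense⟩ := exists_zariski_dense_real_fiber H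
    ⟨projL pE, hGe, star_projL_pE⟩ 2 ⟨Pi.single 4 1, by simp [H, eval_legPoly_pE]; norm_num⟩
    (fun x _ => gradAt_legPoly_pE_ne_zero x) hrank
  have hx₀' : eval x₀ (legPoly (projL pE)) = 2 := hx₀
  refine ⟨x₀, by rw [legForm_halfTurn_ofReal star_projL_pE, hx₀']; simp, ?_⟩
  set v₀ : IsoCoord → ℂ := halfTurn fun k => (x₀ k : ℂ) with hv₀
  -- the points of `E` are half-turns that satisfy the same linear conditions as `x₀`
  have hE4 {x} (hx : x ∈ E) : x 4 * (x 0 ^ 2 + x 1 ^ 2 + 1) = 1 := by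
    have h := (hEH x hx ⟨projL pE, hGe, star_projL_pE⟩).trans hx₀
    have h' : eval x (legPoly (projL pE)) = 2 := h
    rw [eval_legPoly_pE] at h'
    linarith
  have hE4' {x} (hx : x ∈ E) : (x 4 : ℂ) ≠ 0 :=
    Complex.ofReal_ne_zero.mpr (left_ne_zero_of_mul_eq_one (hE4 hx))
  have hEleg {x} (hx : x ∈ E) {g} (hg : g ∈ G) :
      legForm g (halfTurn fun k => (x k : ℂ)) = legForm g v₀ := by
    obtain ⟨a, ha, b, hb, rfl⟩ := exists_real_decomposition hGreal hg
    have h1 : eval x (legPoly a) = eval x₀ (legPoly a) := hEH x hx ⟨a, ha⟩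
    have h2 : eval x (legPoly b) = eval x₀ (legPoly b) := hEH x hx ⟨b, hb⟩
    simp only [legForm_add_left, legForm_smul_left, hv₀, legForm_halfTurn_ofReal ha.2,
      legForm_halfTurn_ofReal hb.2, h1, h2]
  set A := invVariety ∩ dualInS (G.map (legLift v₀)) with hA
  set E' : Set IsoSpace := realHalfTurnPoint '' E with hE'
  have hE'A : E' ⊆ A := by
    rintro _ ⟨x, hx, rfl⟩
    refine ⟨halfTurnPoint_mem_invVariety (by exact_mod_cast hE4 hx),
      halfTurnPoint_mem_symSpace _, ?_⟩
    rintro _ ⟨g, hg, rfl⟩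
    obtain ⟨a, ha, h⟩ := exists_rep_mk_eq_smul (halfTurn_ne_zero fun k => (x k : ℂ))
    rw [symSphereForm_legLift, realHalfTurnPoint, halfTurnPoint, h, legForm_smul_right, hEleg hx hg]
    simp [halfTurn]
    ring
  have hE'real : E' ⊆ realPoints := by
    rintro _ ⟨x, -, rfl⟩
    exact realHalfTurnPoint_mem_realPoints x
  have hE'inf : E'.Infinite := by
    refine hEinf.image fun x hx y hy hxy => ?_
    have h : (fun k => (x k : ℂ)) = fun k => (y k : ℂ) := by
      exact (chart_rep_halfTurnPoint (z := fun k => (x k : ℂ)) (hE4' hx)).symm.trans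
        ((congrArg (fun p : IsoSpace => chart p.rep) hxy).trans
          (chart_rep_halfTurnPoint (z := fun k => (y k : ℂ)) (hE4' hy)))
    exact _root_.funext fun k => Complex.ofReal_injective (congrFun h k)
  have hE'irr : IsIrreducible E' := by
    refine ⟨hE'inf.nonempty, isPreirreducible_zariski_of ?_⟩
    rintro n m f g hf hg ⟨_, ⟨x, hx, rfl⟩, hxf⟩ ⟨_, ⟨y, hy, rfl⟩, hyg⟩
    by_contra! hcon
    rcases hEirr (aeval (halfTurn X) f) (aeval (halfTurn X) g) (fun w hw => by
      have h := hcon _ ⟨w, hw, rfl⟩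
      rw [← map_mul]
      by_contra h'
      exact (eval_rep_realHalfTurnPoint_ne_zero_iff (hf.mul hg) w).mpr h' h) with h | h
    · exact (eval_rep_realHalfTurnPoint_ne_zero_iff hf x).mp hxf (h x hx)
    · exact (eval_rep_realHalfTurnPoint_ne_zero_iff hg y).mp hyg (h y hy)
  -- every irreducible subset of `A` that contains `E'` lies in the closure of `E'`
  have hmax (T : Set IsoSpace) (hT : IsIrreducible T) (hTA : T ⊆ A) (hE'T : E' ⊆ T) :
      T ⊆ closure E' := by
    intro p₀ hp₀
    rw [mem_closure_zariski_iff]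
    intro n f hf hfp₀
    by_contra! hcon
    obtain ⟨x₁, hx₁⟩ := hEinf.nonempty
    have hTD : ∃ p ∈ T, eval p.rep chartDenom ≠ 0 :=
      ⟨_, hE'T ⟨x₁, hx₁, rfl⟩, eval_chartDenom_rep_halfTurnPoint (hE4' hx₁)⟩
    obtain ⟨P, hP, hPmem⟩ := exists_isPrime_chart_vanishing hT.isPreirreducible hTD
    have hchart {p} (hp : p ∈ T) (hD : eval p.rep chartDenom ≠ 0) :
        p.rep .h ≠ 0 ∧ p.rep = p.rep .h • halfTurn (chart p.rep) := by
      rw [eval_chartDenom] at hD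
      obtain ⟨⟨hiso, hsym, htr⟩, -⟩ := hTA hp
      exact ⟨left_ne_zero_of_mul hD, (eq_smul_halfTurn_chart hiso hsym.1 hsym.2 htr
        (left_ne_zero_of_mul hD) (right_ne_zero_of_mul hD)).1⟩
    have hfP : aeval (halfTurn X) f ∈ P := by
      refine hEdense P hP ?_ ?_ _ ?_
      · rintro ⟨g, hg, hgr⟩
        rw [hPmem]
        intro p hp hD
        obtain ⟨hh, hrep⟩ := hchart hp hD
        have h1 := (hTA hp).2.2 _ ⟨g, hg, rfl⟩
        rw [symSphereForm_legLift] at h1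
        have h2 : legForm g p.rep = p.rep .h * legForm g (halfTurn (chart p.rep)) := by
          conv_lhs => rw [hrep]
          exact legForm_smul_right _ _ _
        rw [map_sub, eval_C]
        change eval _ (map Complex.ofRealHom (legPoly g)) - ((eval x₀ (legPoly g) : ℝ) : ℂ) = 0
        rw [eval_map_legPoly hgr, ← legForm_halfTurn_ofReal hgr, ← hv₀]
        refine (mul_eq_zero.mp ?_).resolve_left hh
        rw [← h1, h2]
        ring
      · intro g hg x hx
        have h := (hPmem g).mp hg _ (hE'T ⟨x, hx, rfl⟩)
          (eval_chartDenom_rep_halfTurnPoint (hE4' hx))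
        rwa [realHalfTurnPoint, chart_rep_halfTurnPoint (hE4' hx)] at h
      · intro x hx
        by_contra h
        exact (eval_rep_realHalfTurnPoint_ne_zero_iff hf x).mpr h (hcon _ ⟨x, hx, rfl⟩)
    obtain ⟨p, hp, hpf, hpD⟩ := hT.isPreirreducible.exists_eval_mul_ne_zero hf
      chartDenom_isHomogeneous ⟨p₀, hp₀, hfp₀⟩ hTD
    refine hpf ?_
    rw [(hchart hp hpD).2, hf.eval_smul_point]
    have h := (hPmem _).mp hfP p hp hpD
    rw [eval_aeval_eq] at h
    simp only [map_halfTurn, eval_X] at h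
    exact mul_eq_zero_of_right _ h
  have hE'Z : E' ⊆ A ∩ closure E' := Set.subset_inter hE'A subset_closure
  refine ⟨A ∩ closure E', ⟨⟨⟨hE'irr.1.mono hE'Z, ?_⟩, Set.inter_subset_left⟩, ?_⟩,
    hE'inf.mono hE'Z, ?_⟩
  · rintro u v hu hv ⟨p, hp, hpu⟩ ⟨q, hq, hqv⟩
    obtain ⟨p', hp'u, hp'⟩ := mem_closure_iff.mp hp.2 u hu hpu
    obtain ⟨q', hq'v, hq'⟩ := mem_closure_iff.mp hq.2 v hv hqv
    exact (hE'irr.2 u v hu hv ⟨p', hp', hp'u⟩ ⟨q', hq', hq'v⟩).mono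
      (Set.inter_subset_inter_left _ hE'Z)
  · rintro T ⟨hT, hTA⟩ hZT
    exact Set.subset_inter hTA (hmax T hT hTA (hE'Z.trans hZT))
  · exact Set.inter_subset_right.trans (closure_mono (Set.subset_inter hE'Z hE'real))

theorem mainTheorem5 (G : Submodule ℂ SymLeg) (hG : IsBorelSubspace G)
    (hGreal : IsDefinedOverReals G) :
    ∃ Gt : Submodule ℂ SymLegL,
      Module.finrank ℂ Gt = 4 ∧ IsDefinedOverReals Gt ∧ pE ∈ Gt ∧
      Submodule.map projL Gt = G ∧
      HasRealComponent (invVariety ∩ dualInS Gt) := by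
  obtain ⟨x₀, hpE, hreal⟩ := exists_halfTurn_hasRealComponent hG hGreal
  obtain ⟨hG4, hGe⟩ := hG
  set v₀ : IsoCoord → ℂ := halfTurn fun k => (x₀ k : ℂ)
  have hinj : Function.Injective (legLift v₀) := fun a b h => congrArg Prod.snd h
  refine ⟨G.map (legLift v₀), ?_, ?_, ?_, ?_, hreal⟩
  · exact (Submodule.equivMapOfInjective _ hinj G).finrank_eq.symm.trans hG4
  · rintro _ ⟨g, hg, rfl⟩
    exact ⟨star g, hGreal g hg, (star_legLift x₀ g).symm⟩
  · refine ⟨projL pE, hGe, ?_⟩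
    rw [legLift_apply, hpE]
    simp [projL, pE]
  · rw [← Submodule.map_comp]
    exact Submodule.map_id G
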